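/- **Setting.** Let $\sigma$ be a signature (sorts, and relation symbols with lists of sorts as arities). A $\sigma$-instance $I$ consists of a set $Is$ for each sort $s$ and a relation $Ir\subseteq Is_1\times\cdots\times Is_n$ for each relation symbol $r$ of arity $s_1,\dots,s_n$; morphisms are sorted families of functions preserving the relations. An instance is finite if it has finitely many elements and finitely many tuples, and empty ($\varnothing$) if it has none of either. An embedded dependency $\xi$ is a sentence $\forall x.\,\varphi(x)\Rightarrow\exists y.\,\psi(x,y)$ with $\varphi,\psi$ finite conjunctions of equations between variables and relational atoms; it is a *tgd* if all atoms of $\psi$ are relational, and an *egd* if all atoms of $\psi$ are equations and there are no existential variables $y$. It is represented by the canonical morphism $h:\mathsf{front}\to\mathsf{back}$ from the frozen $\varphi$-instance to the frozen $(\varphi\wedge\psi)$-instance (the frozen instance of a formula has as elements its variables modulo its equations and as tuples its relational atoms). A *trigger* of $\xi$ in $I$ is a morphism $f:\mathsf{front}\to I$; it is *active* if it does not factor through $h$. Let $\mathfrak A$ be a finite set of egds and tgds obtained by rewriting a cartesian theory, i.e. a set of constraints $\forall x.\,\varphi\Rightarrow\exists!\,y.\,\psi$. This means that $\mathfrak A$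 has the same models as the cartesian theory, and that every instance satisfying the egds of $\mathfrak A$ has, for each tgd of $\mathfrak A$ and each $x$ with $\varphi(x)$, at most one $y$ with $\psi(x,y)$. (Replacing each constraint by its existence part, split into a tgd and an egd, together with an egd expressing uniqueness, is such a rewriting.) Let $I_0$ be a finite instance. For a set $\mathcal F$ of triggers in $I$ of dependencies of $\mathfrak A$, the *parallel chase step* $\mathcal C(\mathcal F):I\to I'$ is the pushout of $\coprod_{f\in\mathcal F}h_f:\coprod_f\mathsf{front}_f\to\coprod_f\mathsf{back}_f$ along the copairing $\coprod_f\mathsf{front}_f\to I$ of the triggers in $\mathcal F$. An *edit* $(u,A,i,j):I\Longrightarrow J$ consists of a morphism $u:I\to J$ and monomorphisms $i:A\hookrightarrow I$, $j:A\hookrightarrow J$ with $u\circ i=j$. Edits are composed by composing the morphisms $u$ and taking the pullback of the middle legs. A morphism $f:K\to J$ is *old* for this edit if its image (elements and tuples) is contained in the image of $j$, and *new* otherwise. The parallel chase step is *implemented as an edit* if each $\mathcal C(\mathcal F)$ is given as the underlying morphism of a chosen edit. **Fast parallel chase.** Start with $I_{\rm cur}=I_0$, $i=\mathrm{id}$.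 Repeat the following at least once, and as long as $I_{\rm cur}$ has active triggers of tgds: chase all active triggers of tgds in parallel; then, while there are active triggers of egds, chase all of these in parallel. Throughout, update $I_{\rm cur}$ to be the new instance and compose $i$ with the chase steps. Return $(I_{\rm cur},\,i:I_0\to I_{\rm cur})$. **Semi-naïve algorithm.** Chase in parallel all active triggers in $I_0$ of dependencies with empty $\mathsf{front}$, giving $i:I_0\to I_{\rm tgd}$. Let $e_{\rm tgd}$ be the edit $\varnothing\Longrightarrow I_{\rm tgd}$ with $A=\varnothing$. Repeat the following at least once, and as long as the set $\mathrm{TGD}$ of triggers of tgds in $I_{\rm tgd}$ that are $e_{\rm tgd}$-new and active is nonempty. Chase $\mathrm{TGD}$ by an edit $\mathcal C(\mathrm{TGD}):I_{\rm tgd}\Longrightarrow I_{\rm egd}$, and compose $i$ with it. Set $e_{\rm tgd}:=\mathcal C(\mathrm{TGD})$; set $e_{\rm egd}$ to be the edit $\varnothing\Longrightarrow I_{\rm egd}$ with $A=\varnothing$ in the first round and $\mathcal C(\mathrm{TGD})$ in later rounds. While the set $\mathrm{EGD}$ of triggers of egds in $I_{\rm egd}$ that are $e_{\rm egd}$-new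 and active is nonempty: chase $\mathrm{EGD}$ by an edit $\mathcal C(\mathrm{EGD})$, compose $i$ and $e_{\rm tgd}$ with it, set $e_{\rm egd}:=\mathcal C(\mathrm{EGD})$, and let $I_{\rm egd}$ be its target. Then set $I_{\rm tgd}:=I_{\rm egd}$. At the end, return $(I_{\rm tgd},\,i:I_0\to I_{\rm tgd})$. **Proposition.** Assume that the parallel chase step is implemented as an edit, in any way. Then the semi-naïve algorithm computes the same function as the fast parallel chase algorithm, and both converge for exactly the same inputs. That is, for every such $\sigma$, $\mathfrak A$ and $I_0$, one algorithm terminates if and only if the other does, and in that case their results $(I,\,i:I_0\to I)$ and $(I',\,i':I_0\to I')$ are isomorphic under $I_0$ (there is an isomorphism $\theta:I\to I'$ with $\theta\circ i=i'$). -/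

import Mathlib

universe u

open CategoryTheory CategoryTheory.Limits

noncomputable section

namespace Chase

/-! ### Signatures and instances -/

/-- A signature: sorts, relation symbols, and a list of sorts as the arity of each symbol. -/
structure Signature : Type (u + 1) where
  Srt : Type u
  Rel : Type u
  arity : Rel → List Srt

/-- The tuples of elements of a sorted family `Γ` that have the arity of `r`. -/
abbrev Signature.Tuple (σ : Signature.{u}) (Γ : σ.Srt → Type u) (r : σ.Rel) : Type u :=
  ∀ k : Fin (σ.arity r).length, Γ ((σ.arity r).get k)

/-- A `σ`-instance. -/
structure Inst (σ : Signature.{u}) : Type (u + 1) where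
  carrier : σ.Srt → Type u
  rel : ∀ r : σ.Rel, Set (σ.Tuple carrier r)

variable {σ : Signature.{u}}

/-- A morphism of `σ`-instances: a sorted family of functions that preserves the relations. -/
@[ext]
structure Inst.Hom (I J : Inst σ) : Type u where
  app : ∀ s, I.carrier s → J.carrier s
  map_rel : ∀ (r : σ.Rel) (v : σ.Tuple I.carrier r), v ∈ I.rel r →
    (fun k => app _ (v k)) ∈ J.rel r

instance : Category (Inst σ) where
  Hom I J := Inst.Hom I J
  id I := ⟨fun _ x => x, fun _ _ h => h⟩
  comp f g := ⟨fun s x => g.app s (f.app s x), fun r v h => g.map_rel r _ (f.map_rel r v h)⟩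

/-- An instance is finite if it has finitely many elements and finitely many tuples in all. -/
def Inst.IsFinite (I : Inst σ) : Prop :=
  Finite (Σ s, I.carrier s) ∧ Finite (Σ r, I.rel r)

/-- An instance is empty if it has no element (of any sort) and no tuple (in any relation). -/
def Inst.IsEmptyInst (I : Inst σ) : Prop :=
  (∀ s, IsEmpty (I.carrier s)) ∧ ∀ r, I.rel r = ∅

/-- The empty instance. -/
def Inst.empty (σ : Signature.{u}) : Inst σ := ⟨fun _ => PEmpty, fun _ => ∅⟩

/-- The unique morphism out of the empty instance. -/
def Inst.fromEmpty (I : Inst σ) : Inst.empty σ ⟶ I :=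
  Inst.Hom.mk (fun _ x => x.elim) (fun _ _ h => h.elim)

/-! ### Regular formulas and embedded dependencies -/

/-- Atoms in variables from the sorted family `Γ`. -/
inductive Atom (σ : Signature.{u}) (Γ : σ.Srt → Type u) : Type u
  | eq (s : σ.Srt) (x y : Γ s) : Atom σ Γ
  | rel (r : σ.Rel) (v : σ.Tuple Γ r) : Atom σ Γ

/-- Equational atoms. -/
def Atom.IsEquational {Γ : σ.Srt → Type u} : Atom σ Γ → Prop
  | .eq _ _ _ => True
  | .rel _ _ => False

/-- Relational atoms. -/
def Atom.IsRelational {Γ : σ.Srt → Type u} : Atom σ Γ → Prop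
  | .eq _ _ _ => False
  | .rel _ _ => True

/-- Substitution of variables for variables. -/
def Atom.map {Γ Δ : σ.Srt → Type u} (f : ∀ s, Γ s → Δ s) : Atom σ Γ → Atom σ Δ
  | .eq s x y => .eq s (f s x) (f s y)
  | .rel r v => .rel r (fun k => f _ (v k))

/-- Truth of an atom in `I` under an assignment `a` of elements to the variables. -/
def Atom.Holds {Γ : σ.Srt → Type u} (I : Inst σ) (a : ∀ s, Γ s → I.carrier s) :
    Atom σ Γ → Prop
  | .eq s x y => a s x = a s y
  | .rel r v => (fun k => a _ (v k)) ∈ I.rel r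

/-- Truth in `I`, under an assignment, of the conjunction of the atoms in `φ`. -/
def Holds {Γ : σ.Srt → Type u} (I : Inst σ) (a : ∀ s, Γ s → I.carrier s)
    (φ : Set (Atom σ Γ)) : Prop :=
  ∀ α ∈ φ, α.Holds I a

/-- The frozen `φ`-instance: the variables modulo the equivalence relation generated by the
equational atoms (`Quot` divides by the generated equivalence relation), with the smallest
relations that make the relational atoms true. -/
def frozen {Γ : σ.Srt → Type u} (φ : Set (Atom σ Γ)) : Inst σ where
  carrier s := Quot fun x y : Γ s => Atom.eq s x y ∈ φ
  rel r := {w | ∃ v : σ.Tuple Γ r, Atom.rel r v ∈ φ ∧ w = fun k => Quot.mk _ (v k)}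

/-- The data of a dependency: finitely many universal variables `X`, finitely many existential
variables `Y`, and finite conjunctions `φ(x)` and `ψ(x, y)` of atoms.  Read with `∃`, it is the
embedded dependency `∀ x, φ(x) → ∃ y, ψ(x, y)` (see `Inst.Satisfies`); read with `∃!`, it is the
cartesian constraint `∀ x, φ(x) → ∃! y, ψ(x, y)` (see `Inst.SatisfiesCart`). -/
structure ED (σ : Signature.{u}) : Type (u + 1) where
  X : σ.Srt → Type u
  Y : σ.Srt → Type u
  φ : Set (Atom σ X)
  ψ : Set (Atom σ fun s => X s ⊕ Y s)
  finite_X : Finite (Σ s, X s)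
  finite_Y : Finite (Σ s, Y s)
  finite_φ : φ.Finite
  finite_ψ : ψ.Finite

namespace ED

/-- Combine assignments to the universal and to the existential variables. -/
def join {I : Inst σ} {X Y : σ.Srt → Type u} (a : ∀ s, X s → I.carrier s)
    (b : ∀ s, Y s → I.carrier s) : ∀ s, X s ⊕ Y s → I.carrier s :=
  fun s => Sum.elim (a s) (b s)

/-- Tuple-generating dependency. -/
def IsTgd (ξ : ED σ) : Prop := ∀ α ∈ ξ.ψ, α.IsRelational

/-- Equality-generating dependency (its conclusion equates universal variables). -/
def IsEgd (ξ : ED σ) : Prop := (∀ α ∈ ξ.ψ, α.IsEquational) ∧ ∀ s, IsEmpty (ξ.Y s)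

/-- The premise `φ`, in all variables. -/
def premise (ξ : ED σ) : Set (Atom σ fun s => ξ.X s ⊕ ξ.Y s) :=
  Atom.map (fun _ => Sum.inl) '' ξ.φ

/-- The frozen `φ`-instance. -/
def front (ξ : ED σ) : Inst σ := frozen ξ.φ

/-- The frozen `(φ ∧ ψ)`-instance. -/
def back (ξ : ED σ) : Inst σ := frozen (ξ.premise ∪ ξ.ψ)

/-- The canonical morphism `front ⟶ back`, `[x] ↦ [x]`. -/
def h (ξ : ED σ) : ξ.front ⟶ ξ.back :=
  Inst.Hom.mk
    (fun s => Quot.map (fun x => Sum.inl x)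
      (fun x y hxy => Or.inl ⟨Atom.eq s x y, hxy, rfl⟩))
    (by
      rintro r _ ⟨v, hv, rfl⟩
      exact ⟨fun k => Sum.inl (v k), Or.inl ⟨Atom.rel r v, hv, rfl⟩, rfl⟩)

end ED

/-- `I ⊨ ∀ x, φ(x) → ∃ y, ψ(x, y)`. -/
def Inst.Satisfies (I : Inst σ) (ξ : ED σ) : Prop :=
  ∀ a : ∀ s, ξ.X s → I.carrier s, Holds I a ξ.φ →
    ∃ b : ∀ s, ξ.Y s → I.carrier s, Holds I (ED.join a b) ξ.ψ

/-- `I ⊨ ∀ x, φ(x) → ∃! y, ψ(x, y)`. -/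
def Inst.SatisfiesCart (I : Inst σ) (ξ : ED σ) : Prop :=
  ∀ a : ∀ s, ξ.X s → I.carrier s, Holds I a ξ.φ →
    ∃! b : ∀ s, ξ.Y s → I.carrier s, Holds I (ED.join a b) ξ.ψ

/-- `I ⊨ ∀ x y y', φ(x) ∧ ψ(x, y) ∧ ψ(x, y') → y = y'`. -/
def Inst.SatisfiesUniqueness (I : Inst σ) (ξ : ED σ) : Prop :=
  ∀ a : ∀ s, ξ.X s → I.carrier s, Holds I a ξ.φ →
    ∀ b b' : ∀ s, ξ.Y s → I.carrier s,
      Holds I (ED.join a b) ξ.ψ → Holds I (ED.join a b') ξ.ψ → b = b'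

/-! ### Theories, and cartesian theories rewritten as sets of egds and tgds -/

/-- A regular theory is a set of embedded dependencies. -/
abbrev RegularTheory (σ : Signature.{u}) := Set (ED σ)

/-- A cartesian theory is a set of constraints `∀ x, φ(x) → ∃! y, ψ(x, y)`. -/
abbrev CartesianTheory (σ : Signature.{u}) := Set (ED σ)

/-- `𝔄` is a rewriting of the cartesian theory `T` by egds and tgds: it consists of egds and tgds,
it has the models of `T`, and the `∃` in each of its tgds is a rewritten `∃!`, the uniqueness
being expressed by the egds of `𝔄`.
The standard rewriting has these properties, see `isRewriting_rewrite`. -/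
structure IsRewriting (T : CartesianTheory σ) (𝔄 : RegularTheory σ) : Prop where
  egd_or_tgd : ∀ ξ ∈ 𝔄, ξ.IsEgd ∨ ξ.IsTgd
  models_iff : ∀ I : Inst σ, (∀ ξ ∈ 𝔄, I.Satisfies ξ) ↔ ∀ ξ ∈ T, I.SatisfiesCart ξ
  uniqueness : ∀ ξ ∈ 𝔄, ξ.IsTgd → ∀ I : Inst σ,
    (∀ ζ ∈ 𝔄, ζ.IsEgd → I.Satisfies ζ) → I.SatisfiesUniqueness ξ

/-! #### The standard rewriting -/

namespace ED

/-- The egd `∀ x y y', φ(x) ∧ ψ(x, y) ∧ ψ(x, y') → y = y'`. -/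
def uniquenessEgd (ξ : ED σ) : ED σ where
  X s := ξ.X s ⊕ (ξ.Y s ⊕ ξ.Y s)
  Y _ := PEmpty
  φ := Atom.map (fun _ => Sum.inl) '' ξ.φ ∪
    (Atom.map (fun _ => Sum.map id Sum.inl) '' ξ.ψ ∪
      Atom.map (fun _ => Sum.map id Sum.inr) '' ξ.ψ)
  ψ := Set.range fun p : Σ s, ξ.Y s =>
    Atom.eq p.1 (Sum.inl (Sum.inr (Sum.inl p.2))) (Sum.inl (Sum.inr (Sum.inr p.2)))
  finite_X := by
    have := ξ.finite_X
    have := ξ.finite_Y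
    exact Finite.of_injective
      (β := (Σ s, ξ.X s) ⊕ ((Σ s, ξ.Y s) ⊕ (Σ s, ξ.Y s)))
      (fun p => match p with
        | ⟨s, .inl x⟩ => .inl ⟨s, x⟩
        | ⟨s, .inr (.inl y)⟩ => .inr (.inl ⟨s, y⟩)
        | ⟨s, .inr (.inr y)⟩ => .inr (.inr ⟨s, y⟩))
      (by
        rintro ⟨s, x | x | x⟩ ⟨t, y | y | y⟩ hxy <;> simp at hxy <;>
          obtain ⟨rfl, hxy⟩ := hxy <;> cases hxy <;> rfl)
  finite_Y := by
    have : IsEmpty (Σ _ : σ.Srt, PEmpty.{u + 1}) := ⟨fun p => p.2.elim⟩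
    infer_instance
  finite_φ := (ξ.finite_φ.image _).union ((ξ.finite_ψ.image _).union (ξ.finite_ψ.image _))
  finite_ψ := by
    have := ξ.finite_Y
    exact Set.finite_range _

/-- The variables modulo the equations in `ψ`. -/
def Cls (ξ : ED σ) (s : σ.Srt) : Type u :=
  Quot fun v w : ξ.X s ⊕ ξ.Y s => Atom.eq s v w ∈ ξ.ψ

/-- The class of a variable. -/
def cls (ξ : ED σ) (s : σ.Srt) (v : ξ.X s ⊕ ξ.Y s) : ξ.Cls s := Quot.mk _ v

/-- Classes without a universal variable. -/
def NewVar (ξ : ED σ) (s : σ.Srt) : Type u := {q : ξ.Cls s // ∀ x, ξ.cls s (Sum.inl x) ≠ q}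

open Classical in
/-- A representative of a class of variables: a universal variable where there is one. -/
def repCls (ξ : ED σ) (s : σ.Srt) (q : ξ.Cls s) : ξ.X s ⊕ ξ.NewVar s :=
  if hq : ∃ x, ξ.cls s (Sum.inl x) = q then Sum.inl hq.choose
  else Sum.inr ⟨q, fun x hx => hq ⟨x, hx⟩⟩

/-- Replace a variable with the representative of its class. -/
def rep (ξ : ED σ) (s : σ.Srt) (v : ξ.X s ⊕ ξ.Y s) : ξ.X s ⊕ ξ.NewVar s :=
  ξ.repCls s (ξ.cls s v)

/-- The tgd obtained from the embedded dependency by eliminating the equations of `ψ`. -/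
def tgdPart (ξ : ED σ) : ED σ where
  X := ξ.X
  Y := ξ.NewVar
  φ := ξ.φ
  ψ := Atom.map ξ.rep '' {α ∈ ξ.ψ | α.IsRelational}
  finite_X := ξ.finite_X
  finite_Y := by
    have := ξ.finite_X
    have := ξ.finite_Y
    have : Finite (Σ s, ξ.X s ⊕ ξ.Y s) :=
      Finite.of_equiv _ (Equiv.sigmaSumDistrib ξ.X ξ.Y).symm
    have : Finite (Σ s, ξ.Cls s) :=
      Finite.of_surjective (fun p : Σ s, ξ.X s ⊕ ξ.Y s => (⟨p.1, ξ.cls p.1 p.2⟩ : Σ s, ξ.Cls s))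
        (by rintro ⟨s, ⟨v⟩⟩; exact ⟨⟨s, v⟩, rfl⟩)
    exact Finite.of_injective (fun p : Σ s, ξ.NewVar s => (⟨p.1, p.2.1⟩ : Σ s, ξ.Cls s))
      (by
        rintro ⟨s, q, hq⟩ ⟨t, q', hq'⟩ hh
        obtain ⟨rfl, hh⟩ := Sigma.mk.inj_iff.1 hh
        cases hh
        rfl)
  finite_φ := ξ.finite_φ
  finite_ψ := (ξ.finite_ψ.subset (Set.sep_subset _ _)).image _

/-- The egd that equates the universal variables which the equations of `ψ` identify. -/
def egdPart (ξ : ED σ) : ED σ where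
  X := ξ.X
  Y _ := PEmpty
  φ := ξ.φ
  ψ := (fun p : Σ s, ξ.X s × ξ.X s => Atom.eq p.1 (Sum.inl p.2.1) (Sum.inl p.2.2)) ''
    {p | ξ.cls p.1 (Sum.inl p.2.1) = ξ.cls p.1 (Sum.inl p.2.2)}
  finite_X := ξ.finite_X
  finite_Y := by
    have : IsEmpty (Σ _ : σ.Srt, PEmpty.{u + 1}) := ⟨fun p => p.2.elim⟩
    infer_instance
  finite_φ := ξ.finite_φ
  finite_ψ := by
    have := ξ.finite_X
    have : Finite (Σ s, ξ.X s × ξ.X s) :=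
      Finite.of_injective
        (fun p => ((⟨p.1, p.2.1⟩, ⟨p.1, p.2.2⟩) : (Σ s, ξ.X s) × (Σ s, ξ.X s)))
        (by
          rintro ⟨s, x, x'⟩ ⟨t, y, y'⟩ hh
          simp only [Prod.mk.injEq, Sigma.mk.injEq] at hh
          obtain ⟨⟨rfl, h1⟩, _, h2⟩ := hh
          cases h1
          cases h2
          rfl)
    exact (Set.toFinite _).image _

end ED

/-- The standard rewriting: each `∀ x, φ(x) → ∃! y, ψ(x, y)` is replaced with
`∀ x, φ(x) → ∃ y, ψ(x, y)`, split into a tgd and an egd, and an egd that expresses uniqueness. -/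
def rewrite (T : CartesianTheory σ) : RegularTheory σ :=
  {ζ | ∃ ξ ∈ T, ζ = ξ.tgdPart ∨ ζ = ξ.egdPart ∨ ζ = ξ.uniquenessEgd}

theorem holds_image {Γ Δ : σ.Srt → Type u} {I : Inst σ} {a : ∀ s, Δ s → I.carrier s}
    {f : ∀ s, Γ s → Δ s} {φ : Set (Atom σ Γ)} :
    Holds I a (Atom.map f '' φ) ↔ Holds I (fun s x => a s (f s x)) φ := by
  constructor
  · intro hh α hα
    have := hh _ ⟨α, hα, rfl⟩
    cases α <;> exact this
  · rintro hh _ ⟨α, hα, rfl⟩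
    have := hh α hα
    cases α <;> exact this

theorem holds_union {Γ : σ.Srt → Type u} {I : Inst σ} {a : ∀ s, Γ s → I.carrier s}
    {φ ψ : Set (Atom σ Γ)} : Holds I a (φ ∪ ψ) ↔ Holds I a φ ∧ Holds I a ψ :=
  ⟨fun hh => ⟨fun α hα => hh α (Or.inl hα), fun α hα => hh α (Or.inr hα)⟩,
    fun hh α hα => hα.elim (hh.1 α) (hh.2 α)⟩

theorem satisfies_uniquenessEgd {I : Inst σ} {ξ : ED σ} :
    I.Satisfies ξ.uniquenessEgd ↔ I.SatisfiesUniqueness ξ := by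
  have key : ∀ a : ∀ s, ξ.uniquenessEgd.X s → I.carrier s,
      Holds I a ξ.uniquenessEgd.φ ↔
        Holds I (fun s x => a s (Sum.inl x)) ξ.φ ∧
        Holds I (ED.join (fun s x => a s (Sum.inl x)) (fun s y => a s (Sum.inr (Sum.inl y)))) ξ.ψ ∧
        Holds I (ED.join (fun s x => a s (Sum.inl x))
          (fun s y => a s (Sum.inr (Sum.inr y)))) ξ.ψ := by
    intro a
    have e1 : (fun s x => a s (Sum.map id Sum.inl x)) =
        ED.join (Y := ξ.Y) (fun s x => a s (Sum.inl x))
          (fun s y => a s (Sum.inr (Sum.inl y))) := by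
      funext s x; cases x <;> rfl
    have e2 : (fun s x => a s (Sum.map id Sum.inr x)) =
        ED.join (Y := ξ.Y) (fun s x => a s (Sum.inl x))
          (fun s y => a s (Sum.inr (Sum.inr y))) := by
      funext s x; cases x <;> rfl
    refine holds_union.trans (and_congr holds_image (holds_union.trans (and_congr ?_ ?_)))
    · rw [← e1]
      exact holds_image
    · rw [← e2]
      exact holds_image
  constructor
  · intro hh a ha b b' hb hb'
    obtain ⟨c, hc⟩ := hh (fun s => Sum.elim (a s) (Sum.elim (b s) (b' s)))
      ((key _).2 ⟨ha, hb, hb'⟩)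
    funext s y
    exact hc _ ⟨⟨s, y⟩, rfl⟩
  · intro hh a ha
    obtain ⟨h1, h2, h3⟩ := (key a).1 ha
    refine ⟨fun _ y => y.elim, ?_⟩
    rintro _ ⟨⟨s, y⟩, rfl⟩
    exact congrFun (congrFun (hh _ h1 _ _ h2 h3) s) y

theorem satisfies_egdPart {I : Inst σ} {ξ : ED σ} :
    I.Satisfies ξ.egdPart ↔ ∀ a : ∀ s, ξ.X s → I.carrier s, Holds I a ξ.φ →
      ∀ s x x', ξ.cls s (Sum.inl x) = ξ.cls s (Sum.inl x') → a s x = a s x' := by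
  constructor
  · intro hh a ha s x x' hx
    obtain ⟨c, hc⟩ := hh a ha
    exact hc _ ⟨⟨s, x, x'⟩, hx, rfl⟩
  · intro hh a ha
    refine ⟨fun _ y => y.elim, ?_⟩
    rintro _ ⟨⟨s, x, x'⟩, hx, rfl⟩
    exact hh a ha s x x' hx

theorem ED.rep_new (ξ : ED σ) {s : σ.Srt} (v : ξ.X s ⊕ ξ.Y s)
    (hv : ∀ x, ξ.cls s (Sum.inl x) ≠ ξ.cls s v) : ξ.rep s v = Sum.inr ⟨ξ.cls s v, hv⟩ := by
  unfold ED.rep ED.repCls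
  rw [dif_neg]
  rintro ⟨x, hx⟩
  exact hv x hx

theorem ED.rep_old (ξ : ED σ) {s : σ.Srt} (v : ξ.X s ⊕ ξ.Y s)
    (hv : ∃ x, ξ.cls s (Sum.inl x) = ξ.cls s v) :
    ∃ x, ξ.cls s (Sum.inl x) = ξ.cls s v ∧ ξ.rep s v = Sum.inl x := by
  refine ⟨hv.choose, hv.choose_spec, ?_⟩
  unfold ED.rep ED.repCls
  rw [dif_pos hv]

/-- Witnesses for `ψ` give witnesses for the conclusion of the tgd part. -/
theorem holds_tgdPart {I : Inst σ} {ξ : ED σ} {a : ∀ s, ξ.X s → I.carrier s}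
    {b : ∀ s, ξ.Y s → I.carrier s} (hb : Holds I (ED.join a b) ξ.ψ) :
    (∀ s x x', ξ.cls s (Sum.inl x) = ξ.cls s (Sum.inl x') → a s x = a s x') ∧
      ∃ c : ∀ s, ξ.NewVar s → I.carrier s, Holds I (ED.join a c) ξ.tgdPart.ψ := by
  let d : ∀ s, ξ.Cls s → I.carrier s :=
    fun s => Quot.lift (ED.join a b s) (fun x y hxy => hb _ hxy)
  have hd : ∀ s v, d s (ξ.cls s v) = ED.join a b s v := fun s v => rfl
  refine ⟨fun s x x' hx => ?_, fun s q => d s q.1, ?_⟩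
  · have := congrArg (d s) hx
    rwa [hd, hd] at this
  · have e : (fun s v => ED.join a (fun s (q : ξ.NewVar s) => d s q.1) s (ξ.rep s v)) =
        ED.join a b := by
      funext s v
      by_cases hv : ∃ x, ξ.cls s (Sum.inl x) = ξ.cls s v
      · obtain ⟨x, hx, hr⟩ := ξ.rep_old v hv
        rw [hr, ← hd s v, ← hx]
        rfl
      · push Not at hv
        rw [ξ.rep_new v hv]
        rfl
    refine holds_image.2 ?_
    rw [e]
    exact fun α hα => hb α hα.1

/-- Witnesses for the conclusion of the tgd part give witnesses for `ψ`. -/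
theorem holds_of_tgdPart {I : Inst σ} {ξ : ED σ} {a : ∀ s, ξ.X s → I.carrier s}
    {c : ∀ s, ξ.NewVar s → I.carrier s}
    (ha : ∀ s x x', ξ.cls s (Sum.inl x) = ξ.cls s (Sum.inl x') → a s x = a s x')
    (hc : Holds I (ED.join a c) ξ.tgdPart.ψ) :
    Holds I (ED.join a fun s y => ED.join a c s (ξ.rep s (Sum.inr y))) ξ.ψ := by
  have e : (ED.join a fun s y => ED.join a c s (ξ.rep s (Sum.inr y))) =
      fun s v => ED.join a c s (ξ.rep s v) := by
    funext s v
    cases v with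
    | inl x =>
      obtain ⟨x', hx, hr⟩ := ξ.rep_old (Sum.inl x) ⟨x, rfl⟩
      rw [hr]
      exact ha _ _ _ hx.symm
    | inr y => rfl
  rw [e]
  intro α hα
  cases α with
  | eq s x y =>
    have : ξ.cls s x = ξ.cls s y := Quot.sound hα
    simp only [Atom.Holds, ED.rep, this]
  | rel r v => exact holds_image.1 hc _ ⟨hα, trivial⟩

theorem tgdPart_witness_unique {I : Inst σ} {ξ : ED σ} {c c' : ∀ s, ξ.NewVar s → I.carrier s}
    {a : ∀ s, ξ.X s → I.carrier s}
    (hcc : (fun s y => ED.join a c s (ξ.rep s (Sum.inr y))) =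
      fun s y => ED.join a c' s (ξ.rep s (Sum.inr y))) : c = c' := by
  funext s ⟨q, hq⟩
  obtain ⟨v, rfl⟩ : ∃ v, ξ.cls s v = q := Quot.exists_rep q
  cases v with
  | inl x => exact (hq x rfl).elim
  | inr y =>
    have := congrFun (congrFun hcc s) y
    simp only [ξ.rep_new _ hq] at this
    exact this

theorem satisfiesCart_iff {I : Inst σ} {ξ : ED σ} :
    I.SatisfiesCart ξ ↔
      I.Satisfies ξ.tgdPart ∧ I.Satisfies ξ.egdPart ∧ I.Satisfies ξ.uniquenessEgd := by
  rw [satisfies_uniquenessEgd, satisfies_egdPart]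
  constructor
  · intro hh
    refine ⟨fun a ha => ?_, fun a ha => ?_, fun a ha b b' hb hb' => ?_⟩
    · obtain ⟨b, hb, -⟩ := hh a ha
      exact (holds_tgdPart hb).2
    · obtain ⟨b, hb, -⟩ := hh a ha
      exact (holds_tgdPart hb).1
    · exact (hh a ha).unique hb hb'
  · rintro ⟨h1, h2, h3⟩ a ha
    obtain ⟨c, hc⟩ := h1 a ha
    have hb := holds_of_tgdPart (h2 a ha) hc
    exact ⟨_, hb, fun b' hb' => h3 a ha _ _ hb' hb⟩

theorem ED.isEgd_egdPart (ξ : ED σ) : ξ.egdPart.IsEgd := by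
  refine ⟨?_, fun s => inferInstanceAs (IsEmpty PEmpty)⟩
  rintro _ ⟨p, -, rfl⟩
  trivial

theorem ED.isEgd_uniquenessEgd (ξ : ED σ) : ξ.uniquenessEgd.IsEgd := by
  refine ⟨?_, fun s => inferInstanceAs (IsEmpty PEmpty)⟩
  rintro _ ⟨p, rfl⟩
  trivial

theorem ED.isTgd_tgdPart (ξ : ED σ) : ξ.tgdPart.IsTgd := by
  rintro _ ⟨α, ⟨-, hα⟩, rfl⟩
  cases α with
  | eq s x y => exact hα
  | rel r v => trivial

/-- Every cartesian theory has a rewriting by egds and tgds. -/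
theorem isRewriting_rewrite (T : CartesianTheory σ) : IsRewriting T (rewrite T) where
  egd_or_tgd := by
    rintro _ ⟨ξ, -, rfl | rfl | rfl⟩
    · exact Or.inr ξ.isTgd_tgdPart
    · exact Or.inl ξ.isEgd_egdPart
    · exact Or.inl ξ.isEgd_uniquenessEgd
  models_iff I := by
    constructor
    · intro hh ξ hξ
      exact satisfiesCart_iff.2 ⟨hh _ ⟨ξ, hξ, Or.inl rfl⟩, hh _ ⟨ξ, hξ, Or.inr (Or.inl rfl)⟩,
        hh _ ⟨ξ, hξ, Or.inr (Or.inr rfl)⟩⟩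
    · rintro hh _ ⟨ξ, hξ, rfl | rfl | rfl⟩
      · exact (satisfiesCart_iff.1 (hh ξ hξ)).1
      · exact (satisfiesCart_iff.1 (hh ξ hξ)).2.1
      · exact (satisfiesCart_iff.1 (hh ξ hξ)).2.2
  uniqueness := by
    rintro _ ⟨ξ, hξ, rfl | rfl | rfl⟩ _ I hI a ha c c' hc hc'
    · have h2 := satisfies_egdPart.1 (hI _ ⟨ξ, hξ, Or.inr (Or.inl rfl)⟩ ξ.isEgd_egdPart)
      have h3 := satisfies_uniquenessEgd.1
        (hI _ ⟨ξ, hξ, Or.inr (Or.inr rfl)⟩ ξ.isEgd_uniquenessEgd)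
      exact tgdPart_witness_unique
        (h3 a ha _ _ (holds_of_tgdPart (h2 a ha) hc) (holds_of_tgdPart (h2 a ha) hc'))
    · funext s y
      exact y.elim
    · funext s y
      exact y.elim

theorem finite_rewrite {T : CartesianTheory σ} (hT : T.Finite) : (rewrite T).Finite := by
  refine ((hT.image ED.tgdPart).union ((hT.image ED.egdPart).union
    (hT.image ED.uniquenessEgd))).subset ?_
  rintro _ ⟨ξ, hξ, rfl | rfl | rfl⟩
  · exact Or.inl ⟨ξ, hξ, rfl⟩
  · exact Or.inr (Or.inl ⟨ξ, hξ, rfl⟩)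
  · exact Or.inr (Or.inr ⟨ξ, hξ, rfl⟩)

/-! ### Triggers and parallel chase steps -/

/-- A trigger in `I` of a dependency of `𝔄`. -/
structure Trigger (𝔄 : RegularTheory σ) (I : Inst σ) : Type (u + 1) where
  ξ : ED σ
  mem : ξ ∈ 𝔄
  hom : ξ.front ⟶ I

/-- A trigger is active if it does not factor through `h : front ⟶ back`. -/
def Trigger.IsActive {𝔄 : RegularTheory σ} {I : Inst σ} (t : Trigger 𝔄 I) : Prop :=
  ¬ ∃ g : t.ξ.back ⟶ I, t.ξ.h ≫ g = t.hom

/-- `c : I ⟶ I'` is a parallel chase step for the set `F` of triggers: it is a pushout of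
`∐ h_t : ∐ front_t ⟶ ∐ back_t` along the copairing `∐ front_t ⟶ I` of the triggers `t ∈ F`. -/
def IsParallelChaseStep {𝔄 : RegularTheory σ} {I I' : Inst σ} (F : Set (Trigger 𝔄 I))
    (c : I ⟶ I') : Prop :=
  ∃ (P Q : Inst σ) (p : ∀ t : F, t.1.ξ.front ⟶ P) (q : ∀ t : F, t.1.ξ.back ⟶ Q)
    (f : P ⟶ I) (h : P ⟶ Q) (g : Q ⟶ I'),
    Nonempty (IsColimit (Cofan.mk P p)) ∧ Nonempty (IsColimit (Cofan.mk Q q)) ∧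
    (∀ t : F, p t ≫ f = t.1.hom) ∧ (∀ t : F, p t ≫ h = t.1.ξ.h ≫ q t) ∧
    IsPushout f h c g

/-- An implementation of the parallel chase step: a choice of a parallel chase step for every set
of triggers. -/
structure ParallelChase (𝔄 : RegularTheory σ) : Type (u + 1) where
  tgt : ∀ I : Inst σ, Set (Trigger 𝔄 I) → Inst σ
  hom : ∀ (I : Inst σ) (F : Set (Trigger 𝔄 I)), I ⟶ tgt I F
  isStep : ∀ (I : Inst σ) (F : Set (Trigger 𝔄 I)), IsParallelChaseStep F (hom I F)

/-! ### Edits -/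

/-- An edit from `I` to `J`: a morphism `hom : I ⟶ J` and an instance `A` with monomorphisms `i` to
`I` and `j` to `J` such that `hom ∘ i = j`. -/
structure Edit (I J : Inst σ) : Type (u + 1) where
  hom : I ⟶ J
  A : Inst σ
  i : A ⟶ I
  j : A ⟶ J
  mono_i : Mono i
  mono_j : Mono j
  w : i ≫ hom = j

/-- A morphism `f : K ⟶ J` is old with respect to `e : I ⟹ J` if its image (elements and tuples)
is contained in the image of `j`. -/
def Edit.IsOld {I J K : Inst σ} (e : Edit I J) (f : K ⟶ J) : Prop :=
  (∀ s, Set.range (f.app s) ⊆ Set.range (e.j.app s)) ∧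
  ∀ r, (fun v k => f.app _ (v k)) '' K.rel r ⊆ (fun v k => e.j.app _ (v k)) '' e.A.rel r

/-- A morphism is new with respect to an edit if it is not old. -/
def Edit.IsNew {I J K : Inst σ} (e : Edit I J) (f : K ⟶ J) : Prop := ¬ e.IsOld f

/-- The edit `(!, ∅, !, !) : ∅ ⟹ I`. -/
def Edit.fromEmpty (I : Inst σ) : Edit (Inst.empty σ) I where
  hom := I.fromEmpty
  A := Inst.empty σ
  i := 𝟙 _
  j := I.fromEmpty
  mono_i := inferInstance
  mono_j := ⟨fun f g _ => by
    apply Inst.Hom.ext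
    funext s x
    exact (f.app s x).elim⟩
  w := Category.id_comp _

/-- The pullback of two morphisms of instances. -/
def Inst.pb {I J K : Inst σ} (f : I ⟶ K) (g : J ⟶ K) : Inst σ where
  carrier s := {p : I.carrier s × J.carrier s // f.app s p.1 = g.app s p.2}
  rel r := {v | (fun k => (v k).1.1) ∈ I.rel r ∧ (fun k => (v k).1.2) ∈ J.rel r}

/-- First projection. -/
def Inst.pbFst {I J K : Inst σ} (f : I ⟶ K) (g : J ⟶ K) : Inst.pb f g ⟶ I :=
  Inst.Hom.mk (fun _ p => p.1.1) (fun _ _ h => h.1)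

/-- Second projection. -/
def Inst.pbSnd {I J K : Inst σ} (f : I ⟶ K) (g : J ⟶ K) : Inst.pb f g ⟶ J :=
  Inst.Hom.mk (fun _ p => p.1.2) (fun _ _ h => h.2)

theorem Inst.isPullback_pb {I J K : Inst σ} (f : I ⟶ K) (g : J ⟶ K) :
    IsPullback (Inst.pbFst f g) (Inst.pbSnd f g) f g where
  w := Inst.Hom.ext (by funext s p; exact p.2)
  isLimit' := ⟨PullbackCone.IsLimit.mk _
    (fun c => Inst.Hom.mk
      (fun s x => ⟨(c.fst.app s x, c.snd.app s x),
        congrFun (congrFun (congrArg Inst.Hom.app c.condition) s) x⟩)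
      (fun r v hv => ⟨c.fst.map_rel r v hv, c.snd.map_rel r v hv⟩))
    (fun c => rfl) (fun c => rfl)
    (fun c m h1 h2 => Inst.Hom.ext (by
      funext s x
      apply Subtype.ext
      exact Prod.ext (congrFun (congrFun (congrArg Inst.Hom.app h1) s) x)
        (congrFun (congrFun (congrArg Inst.Hom.app h2) s) x)))⟩

/-- Composition of edits, through the pullback of the middle legs. -/
def Edit.comp {I J K : Inst σ} (e : Edit I J) (e' : Edit J K) : Edit I K where
  hom := e.hom ≫ e'.hom
  A := Inst.pb e.j e'.i
  i := Inst.pbFst e.j e'.i ≫ e.i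
  j := Inst.pbSnd e.j e'.i ≫ e'.j
  mono_i := by
    have := e.mono_i
    have := e'.mono_i
    have := (Inst.isPullback_pb e.j e'.i).mono_fst_of_mono
    exact mono_comp _ _
  mono_j := by
    have := e.mono_j
    have := e'.mono_j
    have := (Inst.isPullback_pb e.j e'.i).mono_snd_of_mono
    exact mono_comp _ _
  w := by
    rw [Category.assoc, ← Category.assoc e.i, e.w, ← Category.assoc,
      (Inst.isPullback_pb e.j e'.i).w, Category.assoc, e'.w]

/-- An implementation of the parallel chase step as an edit. -/
structure EditChase (𝔄 : RegularTheory σ) : Type (u + 1) where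
  tgt : ∀ I : Inst σ, Set (Trigger 𝔄 I) → Inst σ
  edit : ∀ (I : Inst σ) (F : Set (Trigger 𝔄 I)), Edit I (tgt I F)
  isStep : ∀ (I : Inst σ) (F : Set (Trigger 𝔄 I)), IsParallelChaseStep F (edit I F).hom

/-! ### The algorithms

Algorithms denote partial functions, defined where the algorithm halts.  The result on the input
`I₀` is an instance with a morphism from `I₀`, that is, an object of `Under I₀`. -/

open Classical in
/-- `while cond do body`, as a partial function of the state. -/
def whileLoop {α : Type*} (cond : α → Prop) (body : α →. α) : α →. α :=
  PFun.fix fun s => if cond s then (body s).map Sum.inr else Part.some (Sum.inl s)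

section Fast

variable {𝔄 : RegularTheory σ} (C : ParallelChase 𝔄) {I₀ : Inst σ}

/-- The active triggers of tgds. -/
def activeTgd (𝔄 : RegularTheory σ) (I : Inst σ) : Set (Trigger 𝔄 I) :=
  {t | t.ξ.IsTgd ∧ t.IsActive}

/-- The active triggers of egds. -/
def activeEgd (𝔄 : RegularTheory σ) (I : Inst σ) : Set (Trigger 𝔄 I) :=
  {t | t.ξ.IsEgd ∧ t.IsActive}

/-- The inner loop of the fast parallel chase: chase all active triggers of egds while there are
any.  The state is `(I_cur, i)`. -/
def fastEgdLoop : Under I₀ →. Under I₀ :=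
  whileLoop (fun s => (activeEgd 𝔄 s.right).Nonempty)
    (fun s => Part.some (Under.mk (s.hom ≫ C.hom s.right (activeEgd 𝔄 s.right))))

/-- The outer loop of the fast parallel chase.  The state is `((I_cur, i), first)`. -/
def fastTgdLoop : Under I₀ × Bool →. Under I₀ × Bool :=
  whileLoop (fun s => (activeTgd 𝔄 s.1.right).Nonempty ∨ s.2 = true)
    (fun s => (fastEgdLoop C
      (Under.mk (s.1.hom ≫ C.hom s.1.right (activeTgd 𝔄 s.1.right)))).map (fun t => (t, false)))

/-- The fast parallel chase algorithm. -/
def fastChase (I₀ : Inst σ) : Part (Under I₀) :=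
  (fastTgdLoop C (Under.mk (𝟙 I₀), true)).map Prod.fst

end Fast

section SemiNaive

/-- The state of the outer loop of the semi-naive algorithm. -/
structure TgdState (I₀ : Inst σ) : Type (u + 1) where
  I : Inst σ
  i : I₀ ⟶ I
  prev : Inst σ
  e : Edit prev I
  first : Bool

/-- The state of the inner loop of the semi-naive algorithm, which runs with a fixed `I_tgd`. -/
structure EgdState (I₀ Itgd : Inst σ) : Type (u + 1) where
  I : Inst σ
  i : I₀ ⟶ I
  eTgd : Edit Itgd I
  prev : Inst σ
  eEgd : Edit prev I

variable {𝔄 : RegularTheory σ} (E : EditChase 𝔄) {I₀ : Inst σ}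

/-- The new and active triggers of tgds. -/
def newTgd (𝔄 : RegularTheory σ) {J I : Inst σ} (e : Edit J I) : Set (Trigger 𝔄 I) :=
  {t | t.ξ.IsTgd ∧ e.IsNew t.hom ∧ t.IsActive}

/-- The new and active triggers of egds. -/
def newEgd (𝔄 : RegularTheory σ) {J I : Inst σ} (e : Edit J I) : Set (Trigger 𝔄 I) :=
  {t | t.ξ.IsEgd ∧ e.IsNew t.hom ∧ t.IsActive}

/-- The active triggers of dependencies with empty front. -/
def activeEmptyFront (𝔄 : RegularTheory σ) (I : Inst σ) : Set (Trigger 𝔄 I) :=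
  {t | t.ξ.front.IsEmptyInst ∧ t.IsActive}

/-- The inner loop of the semi-naive algorithm. -/
def semiEgdLoop (Itgd : Inst σ) : EgdState I₀ Itgd →. EgdState I₀ Itgd :=
  whileLoop (fun s => (newEgd 𝔄 s.eEgd).Nonempty)
    (fun s =>
      let c := E.edit s.I (newEgd 𝔄 s.eEgd)
      Part.some
        { I := _
          i := s.i ≫ c.hom
          eTgd := s.eTgd.comp c
          prev := s.I
          eEgd := c })

/-- The state at the start of the inner loop: `C(TGD)` has been applied to `I_tgd`; `e_egd` is
`(!, ∅, !, !)` in the first round and `C(TGD)` in later rounds. -/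
def semiEgdInit (s : TgdState I₀) : EgdState I₀ s.I :=
  let c := E.edit s.I (newTgd 𝔄 s.e)
  match s.first with
  | true =>
    { I := _
      i := s.i ≫ c.hom
      eTgd := c
      prev := Inst.empty σ
      eEgd := Edit.fromEmpty _ }
  | false =>
    { I := _
      i := s.i ≫ c.hom
      eTgd := c
      prev := s.I
      eEgd := c }

/-- The outer loop of the semi-naive algorithm. -/
def semiTgdLoop : TgdState I₀ →. TgdState I₀ :=
  whileLoop (fun s => (newTgd 𝔄 s.e).Nonempty ∨ s.first = true)
    (fun s => (semiEgdLoop E s.I (semiEgdInit E s)).map fun t =>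
      { I := t.I
        i := t.i
        prev := s.I
        e := t.eTgd
        first := false })

/-- The semi-naive fast parallel chase algorithm. -/
def semiNaiveChase (I₀ : Inst σ) : Part (Under I₀) :=
  (semiTgdLoop E
    { I := _
      i := (E.edit I₀ (activeEmptyFront 𝔄 I₀)).hom
      prev := Inst.empty σ
      e := Edit.fromEmpty _
      first := true }).map fun s => Under.mk s.i

end SemiNaive

end Chase

end

/-! Both algorithms halt exactly when `I₀` can be brought to a model by some finite sequence of
parallel chase steps, and they then return such a model (`fast_spec`, `semiNaive_spec`). The sets of
triggers in these steps are arbitrary, so the two runs need not be compared round by round.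

Uniqueness of the result: a chase step is a pushout, so a map out of its source extends to its
target as soon as the chased triggers become inactive. Hence every chased instance maps under `I₀`
to every model (`Chased.exists_hom`). Since the egds force existential witnesses to be unique, there
is at most one map under `I₀` from a chased instance to an instance closed under the egds
(`Chased.hom_ext`). Two chased models are therefore isomorphic under `I₀`.

Termination: the egd loops halt because each step strictly lowers the finite number of elements
(`IsParallelChaseStep.numElts_lt`). For the outer loops, suppose that `I₀` is chased to a model `R`
in n steps. Each round deactivates all triggers present at its start, so after k rounds the k-th
instance of that chain maps to the current state. Once `R` itself maps to the state, the state is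
isomorphic to `R` and the loop stops (`whileLoop_dom`).

The semi-naive restriction loses nothing, because old triggers are always inactive: an old trigger
comes from the source of the edit (`Edit.IsOld.exists_fac`), and the edit deactivates whatever comes
from there. Triggers with empty front, the only ones old for the edit out of `∅`, are handled by the
initial step. -/

namespace Chase

variable {σ : Signature.{u}}

/-! ### Homomorphisms out of frozen instances -/

/-- An assignment satisfying `φ` is a morphism out of the frozen `φ`-instance. -/
def frozenHom {Γ : σ.Srt → Type u} {φ : Set (Atom σ Γ)} {I : Inst σ}
    (a : ∀ s, Γ s → I.carrier s) (ha : Holds I a φ) : frozen φ ⟶ I :=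
  Inst.Hom.mk (fun s => Quot.lift (a s) (fun x y hxy => ha (Atom.eq s x y) hxy))
    (by
      rintro r _ ⟨v, hv, rfl⟩
      exact ha _ hv)

/-- The assignment underlying a morphism out of a frozen instance. -/
def assignment {Γ : σ.Srt → Type u} {φ : Set (Atom σ Γ)} {I : Inst σ} (f : frozen φ ⟶ I) :
    ∀ s, Γ s → I.carrier s :=
  fun s x => Inst.Hom.app f s (Quot.mk _ x)

theorem holds_assignment {Γ : σ.Srt → Type u} {φ : Set (Atom σ Γ)} {I : Inst σ}
    (f : frozen φ ⟶ I) : Holds I (assignment f) φ := by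
  rintro (⟨s, x, y⟩ | ⟨r, v⟩) hα
  · exact congrArg (Inst.Hom.app f s) (Quot.sound hα)
  · exact Inst.Hom.map_rel f r _ ⟨v, hα, rfl⟩

theorem frozen_hom_ext {Γ : σ.Srt → Type u} {φ : Set (Atom σ Γ)} {I : Inst σ}
    {f g : frozen φ ⟶ I} (hfg : assignment f = assignment g) : f = g := by
  apply Inst.Hom.ext
  funext s x
  induction x using Quot.ind with
  | mk x => exact congrFun (congrFun hfg s) x

/-- The morphism `f` out of the front of `ξ` factors through `h`. -/
def Factors {I : Inst σ} (ξ : ED σ) (f : ξ.front ⟶ I) : Prop :=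
  ∃ g : ξ.back ⟶ I, ξ.h ≫ g = f

theorem Factors.comp {I J : Inst σ} {ξ : ED σ} {f : ξ.front ⟶ I} (hf : Factors ξ f) (c : I ⟶ J) :
    Factors ξ (f ≫ c) := by
  obtain ⟨g, rfl⟩ := hf
  exact ⟨g ≫ c, by rw [Category.assoc]⟩

/-- The values of the universal variables under a trigger. -/
def ED.frontVal {I : Inst σ} {ξ : ED σ} (f : ξ.front ⟶ I) : ∀ s, ξ.X s → I.carrier s :=
  assignment (φ := ξ.φ) f

/-- The values of all variables under a morphism out of the back. -/
def ED.backVal {I : Inst σ} {ξ : ED σ} (g : ξ.back ⟶ I) : ∀ s, ξ.X s ⊕ ξ.Y s → I.carrier s :=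
  assignment (φ := ξ.premise ∪ ξ.ψ) g

theorem ED.backVal_eq {I : Inst σ} {ξ : ED σ} (g : ξ.back ⟶ I) :
    ED.backVal g =
      ED.join (ED.frontVal (ξ.h ≫ g))
        (fun s y => ED.backVal g s (Sum.inr y)) := by
  funext s x
  cases x <;> rfl

/-- The back is the frozen instance of `φ ∧ ψ`, so extending a trigger along `h` amounts to choosing
values for the existential variables. -/
theorem factors_iff {I : Inst σ} {ξ : ED σ} {f : ξ.front ⟶ I} :
    Factors ξ f ↔ ∃ b, Holds I (ED.join (ED.frontVal f) b) ξ.ψ := by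
  constructor
  · rintro ⟨g, rfl⟩
    refine ⟨fun s y => ED.backVal g s (Sum.inr y), ?_⟩
    rw [← ED.backVal_eq]
    exact (holds_union.1 (holds_assignment (φ := ξ.premise ∪ ξ.ψ) g)).2
  · rintro ⟨b, hb⟩
    refine ⟨frozenHom (φ := ξ.premise ∪ ξ.ψ) _
      (holds_union.2 ⟨holds_image.2 (holds_assignment (φ := ξ.φ) f), hb⟩), ?_⟩
    exact frozen_hom_ext (φ := ξ.φ) rfl

/-- All triggers of the egds of `𝔄` in `I` are inactive. -/
def EgdClosed (𝔄 : RegularTheory σ) (I : Inst σ) : Prop :=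
  ∀ ξ ∈ 𝔄, ξ.IsEgd → ∀ f : ξ.front ⟶ I, Factors ξ f

/-- All triggers of the tgds of `𝔄` in `I` are inactive. -/
def TgdClosed (𝔄 : RegularTheory σ) (I : Inst σ) : Prop :=
  ∀ ξ ∈ 𝔄, ξ.IsTgd → ∀ f : ξ.front ⟶ I, Factors ξ f

theorem satisfies_of_factors {I : Inst σ} {ξ : ED σ} (hI : ∀ f : ξ.front ⟶ I, Factors ξ f) :
    I.Satisfies ξ := fun _ ha => factors_iff.1 (hI (frozenHom (φ := ξ.φ) _ ha))

/-- In an instance that satisfies the egds, a trigger factors through `h` in at most one way. -/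
theorem IsRewriting.back_hom_ext {T : CartesianTheory σ} {𝔄 : RegularTheory σ}
    (h𝔄 : IsRewriting T 𝔄) {K : Inst σ} (hK : EgdClosed 𝔄 K) {ξ : ED σ} (hξ : ξ ∈ 𝔄)
    {u v : ξ.back ⟶ K} (huv : ξ.h ≫ u = ξ.h ≫ v) : u = v := by
  apply frozen_hom_ext (φ := ξ.premise ∪ ξ.ψ)
  change ED.backVal u = ED.backVal v
  have hu : Holds K (ED.backVal u) ξ.ψ :=
    (holds_union.1 (holds_assignment (φ := ξ.premise ∪ ξ.ψ) u)).2
  have hv : Holds K (ED.backVal v) ξ.ψ :=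
    (holds_union.1 (holds_assignment (φ := ξ.premise ∪ ξ.ψ) v)).2
  rw [ED.backVal_eq] at hu hv
  rw [ED.backVal_eq u, ED.backVal_eq v, huv]
  rw [huv] at hu
  -- Only the existential values remain: an egd has none, and for a tgd the egds make them unique.
  congr 1
  rcases h𝔄.egd_or_tgd ξ hξ with h | h
  · funext s y
    exact ((h.2 s).false y).elim
  · exact h𝔄.uniqueness ξ hξ h K (fun ζ hζ hζ' => satisfies_of_factors (hK ζ hζ hζ')) _
      (holds_assignment (φ := ξ.φ) _) _ _ hu hv

/-! ### Parallel chase steps -/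

section Step

variable {𝔄 : RegularTheory σ} {I I' : Inst σ} {F : Set (Trigger 𝔄 I)} {c : I ⟶ I'}

/-- The universal property of a parallel chase step. -/
theorem IsParallelChaseStep.exists_universal (hc : IsParallelChaseStep F c) :
    ∃ b : ∀ t : F, t.1.ξ.back ⟶ I', (∀ t, t.1.ξ.h ≫ b t = t.1.hom ≫ c) ∧
      (∀ (K : Inst σ) (u v : I' ⟶ K), c ≫ u = c ≫ v → (∀ t, b t ≫ u = b t ≫ v) → u = v) ∧
      ∀ (K : Inst σ) (u : I ⟶ K), (∀ t ∈ F, Factors t.ξ (t.hom ≫ u)) →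
        ∃ m : I' ⟶ K, c ≫ m = u := by
  obtain ⟨P, Q, p, q, f, h, g, ⟨hP⟩, ⟨hQ⟩, hf, hh, hpo⟩ := hc
  refine ⟨fun t => q t ≫ g, fun t => ?_, fun K u v hu hb => ?_, fun K u w => ?_⟩
  · rw [← Category.assoc, ← hh, Category.assoc, ← hpo.w, ← Category.assoc, hf]
  · refine hpo.hom_ext hu (Cofan.IsColimit.hom_ext hQ _ _ fun t => ?_)
    simpa using hb t
  -- Any choice of factorizations assembles to a map out of the coproduct of the backs.
  · choose w hw using fun t : F => w t.1 t.2
    have hd : ∀ t, q t ≫ Cofan.IsColimit.desc hQ w = w t :=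
      fun t => Cofan.IsColimit.fac hQ w t
    refine ⟨hpo.desc u (Cofan.IsColimit.desc hQ w)
      (Cofan.IsColimit.hom_ext hP _ _ fun t => ?_), hpo.inl_desc _ _ _⟩
    change p t ≫ f ≫ u = p t ≫ h ≫ _
    rw [← Category.assoc, hf, ← Category.assoc, hh, Category.assoc, hd, hw]

theorem IsParallelChaseStep.factors (hc : IsParallelChaseStep F c) {t : Trigger 𝔄 I}
    (ht : t ∈ F) : Factors t.ξ (t.hom ≫ c) := by
  obtain ⟨b, hb, -⟩ := hc.exists_universal
  exact ⟨b ⟨t, ht⟩, hb ⟨t, ht⟩⟩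

/-- The elements of the target of a chase step come from `I` or from the backs. -/
theorem IsParallelChaseStep.exists_cover (hc : IsParallelChaseStep F c) :
    ∃ b : ∀ t : F, t.1.ξ.back ⟶ I', (∀ t, t.1.ξ.h ≫ b t = t.1.hom ≫ c) ∧
      ∀ s (y : I'.carrier s), (∃ x, Inst.Hom.app c s x = y) ∨
        ∃ t z, Inst.Hom.app (b t) s z = y := by
  obtain ⟨b, hb, hext, -⟩ := hc.exists_universal
  refine ⟨b, hb, fun s y => ?_⟩
  -- In `K` all tuples hold, so maps into it are arbitrary predicates. The predicates "true" and
  -- "covered" agree on `I` and on the backs, hence everywhere.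
  let K : Inst σ := ⟨fun _ => ULift Prop, fun _ => Set.univ⟩
  let u : I' ⟶ K := Inst.Hom.mk (fun _ _ => ⟨True⟩) (fun _ _ _ => trivial)
  let v : I' ⟶ K := Inst.Hom.mk
    (fun s y => ⟨(∃ x, Inst.Hom.app c s x = y) ∨ ∃ t z, Inst.Hom.app (b t) s z = y⟩)
    (fun _ _ _ => trivial)
  have huv : u = v := by
    refine hext K u v ?_ fun t => ?_
    · apply Inst.Hom.ext
      funext s x
      exact ULift.ext _ _ (eq_true (Or.inl ⟨x, rfl⟩)).symm
    · apply Inst.Hom.ext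
      funext s x
      exact ULift.ext _ _ (eq_true (Or.inr ⟨t, x, rfl⟩)).symm
  have := congrArg (fun w : I' ⟶ K => (Inst.Hom.app w s y).down) huv
  exact of_eq_true this.symm

/-! ### Finiteness, and the decrease in elements under egds -/

/-- Finitely many elements. -/
def Inst.FinElts (I : Inst σ) : Prop := Finite (Σ s, I.carrier s)

theorem finElts_frozen {Γ : σ.Srt → Type u} (φ : Set (Atom σ Γ)) (hΓ : Finite (Σ s, Γ s)) :
    (frozen φ).FinElts :=
  Finite.of_surjective
    (fun p : Σ s, Γ s => (⟨p.1, Quot.mk _ p.2⟩ : Σ s, (frozen φ).carrier s))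
    (by rintro ⟨s, ⟨v⟩⟩; exact ⟨⟨s, v⟩, rfl⟩)

theorem ED.finElts_back (ξ : ED σ) : ξ.back.FinElts := by
  have := ξ.finite_X
  have := ξ.finite_Y
  exact finElts_frozen _ (Finite.of_equiv _ (Equiv.sigmaSumDistrib ξ.X ξ.Y).symm)

theorem finite_hom {I J : Inst σ} (hI : I.FinElts) (hJ : J.FinElts) : Finite (I ⟶ J) := by
  unfold Inst.FinElts at hI hJ
  refine Finite.of_injective
    (fun f => fun p : Σ s, I.carrier s => (⟨p.1, Inst.Hom.app f p.1 p.2⟩ : Σ s, J.carrier s)) ?_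
  intro f g hfg
  apply Inst.Hom.ext
  funext s x
  exact eq_of_heq (Sigma.mk.inj_iff.1 (congrFun hfg ⟨s, x⟩)).2

theorem finite_trigger (h𝔄 : 𝔄.Finite) (hI : I.FinElts) : Finite (Trigger 𝔄 I) := by
  have := h𝔄.to_subtype
  have := fun ξ : 𝔄 => finite_hom (finElts_frozen ξ.1.φ ξ.1.finite_X) hI
  refine Finite.of_injective
    (fun t : Trigger 𝔄 I => (⟨⟨t.ξ, t.mem⟩, t.hom⟩ : Σ ξ : 𝔄, (frozen ξ.1.φ ⟶ I))) ?_
  rintro ⟨ξ, hξ, f⟩ ⟨ζ, hζ, g⟩ hfg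
  obtain ⟨h1, h2⟩ := Sigma.mk.inj_iff.1 hfg
  cases h1
  cases h2
  rfl

theorem IsParallelChaseStep.finElts (hc : IsParallelChaseStep F c) (h𝔄 : 𝔄.Finite)
    (hI : I.FinElts) : I'.FinElts := by
  obtain ⟨b, -, hcov⟩ := hc.exists_cover
  have := finite_trigger h𝔄 hI
  have := fun t : F => t.1.ξ.finElts_back
  unfold Inst.FinElts at *
  refine Finite.of_surjective
    (fun p : (Σ s, I.carrier s) ⊕ (Σ t : F, Σ s, t.1.ξ.back.carrier s) =>
      (Sum.elim (fun p => ⟨p.1, Inst.Hom.app c p.1 p.2⟩)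
        (fun p => ⟨p.2.1, Inst.Hom.app (b p.1) p.2.1 p.2.2⟩) p : Σ s, I'.carrier s)) ?_
  rintro ⟨s, y⟩
  rcases hcov s y with ⟨x, rfl⟩ | ⟨t, z, rfl⟩
  · exact ⟨Sum.inl ⟨s, x⟩, rfl⟩
  · exact ⟨Sum.inr ⟨t, s, z⟩, rfl⟩

/-- The number of elements. -/
noncomputable def Inst.numElts (I : Inst σ) : ℕ := Nat.card (Σ s, I.carrier s)

/-- Chasing active triggers of egds decreases the number of elements. -/
theorem IsParallelChaseStep.numElts_lt (hc : IsParallelChaseStep F c) (hI : I.FinElts)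
    (hF : ∀ t ∈ F, t.ξ.IsEgd ∧ t.IsActive) (hne : F.Nonempty) : I'.numElts < I.numElts := by
  obtain ⟨b, hb, hcov⟩ := hc.exists_cover
  let k : (Σ s, I.carrier s) → Σ s, I'.carrier s := fun p => ⟨p.1, Inst.Hom.app c p.1 p.2⟩
  have hk : Function.Surjective k := by
    rintro ⟨s, y⟩
    rcases hcov s y with ⟨x, rfl⟩ | ⟨t, z, rfl⟩
    · exact ⟨⟨s, x⟩, rfl⟩
    -- An egd has only universal variables, so every element of its back already comes from the
    -- front.
    · obtain ⟨z | z, rfl⟩ := Quot.exists_rep z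
      · refine ⟨⟨s, ED.frontVal t.1.hom s z⟩, Sigma.ext rfl (heq_of_eq ?_)⟩
        exact congrArg (fun w : t.1.ξ.front ⟶ I' => ED.frontVal w s z) (hb t).symm
      · exact (((hF t.1 t.2).1.2 s).false z).elim
  unfold Inst.FinElts at hI
  refine lt_of_le_of_ne (Nat.card_le_card_of_surjective k hk) fun hcard => ?_
  -- If no elements were merged, the equations forced in `I'` would already hold in `I`, and an
  -- active trigger would factor.
  have hinj : Function.Injective k := (Nat.bijective_iff_surjective_and_card k).2
    ⟨hk, hcard.symm⟩ |>.1
  obtain ⟨t, ht⟩ := hne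
  obtain ⟨⟨he, hY⟩, hact⟩ := hF t ht
  refine hact (factors_iff.2 ?_)
  obtain ⟨d, hd⟩ := factors_iff.1 (hc.factors ht)
  refine ⟨fun s y => ((hY s).false y).elim, ?_⟩
  rintro (⟨s, x, y⟩ | ⟨r, v⟩) hα
  · rcases x with x | x
    · rcases y with y | y
      · have h1 : Inst.Hom.app c s (ED.frontVal t.hom s x) =
            Inst.Hom.app c s (ED.frontVal t.hom s y) := hd _ hα
        have h2 := @hinj ⟨s, ED.frontVal t.hom s x⟩
          ⟨s, ED.frontVal t.hom s y⟩ (congrArg (Sigma.mk s) h1)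
        exact eq_of_heq (Sigma.mk.inj_iff.1 h2).2
      · exact ((hY s).false y).elim
    · exact ((hY s).false x).elim
  · exact (he _ hα).elim

end Step

/-! ### Chased instances -/

section Chased

variable {𝔄 : RegularTheory σ} {I₀ : Inst σ}

/-- `Y` is obtained from `X` by a parallel chase step. -/
def ChaseRel (𝔄 : RegularTheory σ) (X Y : Under I₀) : Prop :=
  ∃ (F : Set (Trigger 𝔄 X.right)) (c : X.right ⟶ Y.right),
    IsParallelChaseStep F c ∧ X.hom ≫ c = Y.hom

/-- `X` is obtained from `I₀` by finitely many parallel chase steps. -/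
def Chased (𝔄 : RegularTheory σ) (X : Under I₀) : Prop :=
  Relation.ReflTransGen (ChaseRel 𝔄) (Under.mk (𝟙 I₀)) X

theorem Chased.step {I I' : Inst σ} {i : I₀ ⟶ I} (hX : Chased 𝔄 (Under.mk i))
    {F : Set (Trigger 𝔄 I)} {c : I ⟶ I'} (hc : IsParallelChaseStep F c) :
    Chased 𝔄 (Under.mk (i ≫ c)) :=
  hX.tail ⟨F, c, hc, rfl⟩

/-- The target of a step is jointly covered by its source and the backs; on a back, a map into `K`
is determined by its restriction to the front (`IsRewriting.back_hom_ext`). -/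
theorem Chased.hom_ext {T : CartesianTheory σ} (h𝔄 : IsRewriting T 𝔄) {X : Under I₀}
    (hX : Chased 𝔄 X) {K : Inst σ} (hK : EgdClosed 𝔄 K) {u v : X.right ⟶ K}
    (huv : X.hom ≫ u = X.hom ≫ v) : u = v := by
  induction hX with
  | refl => simpa using huv
  | tail _ hYZ ih =>
    obtain ⟨F, c, hc, hw⟩ := hYZ
    obtain ⟨b, hb, hext, -⟩ := hc.exists_universal
    have hcu : c ≫ u = c ≫ v := by
      apply ih
      rw [← Category.assoc, ← Category.assoc, hw, huv]
    refine hext K u v hcu fun t => h𝔄.back_hom_ext hK t.1.mem ?_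
    rw [← Category.assoc, ← Category.assoc, hb, Category.assoc, Category.assoc, hcu]

theorem IsRewriting.factors {T : CartesianTheory σ} (h𝔄 : IsRewriting T 𝔄) {K : Inst σ}
    (hK : EgdClosed 𝔄 K) (hK' : TgdClosed 𝔄 K) {ξ : ED σ} (hξ : ξ ∈ 𝔄) (f : ξ.front ⟶ K) :
    Factors ξ f :=
  (h𝔄.egd_or_tgd ξ hξ).elim (fun h => hK ξ hξ h f) (fun h => hK' ξ hξ h f)

/-- In a model every trigger factors, so the map from `I₀` extends along each step in turn. -/
theorem Chased.exists_hom {T : CartesianTheory σ} (h𝔄 : IsRewriting T 𝔄) {X : Under I₀}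
    (hX : Chased 𝔄 X) {K : Under I₀} (hK : EgdClosed 𝔄 K.right) (hK' : TgdClosed 𝔄 K.right) :
    Nonempty (X ⟶ K) := by
  induction hX with
  | refl => exact ⟨Under.homMk K.hom (Category.id_comp _)⟩
  | tail _ hYZ ih =>
    obtain ⟨F, c, hc, hw⟩ := hYZ
    obtain ⟨m⟩ := ih
    obtain ⟨-, -, -, hdesc⟩ := hc.exists_universal
    obtain ⟨n, hn⟩ := hdesc K.right m.right fun t _ => h𝔄.factors hK hK' t.mem _
    exact ⟨Under.homMk n (by rw [← hw, Category.assoc, hn, Under.w])⟩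

theorem Chased.iso {T : CartesianTheory σ} (h𝔄 : IsRewriting T 𝔄) {X Y : Under I₀}
    (hX : Chased 𝔄 X) (hY : Chased 𝔄 Y) (hX' : EgdClosed 𝔄 X.right) (hY' : EgdClosed 𝔄 Y.right)
    (f : X ⟶ Y) (g : Y ⟶ X) : Nonempty (X ≅ Y) :=
  ⟨⟨f, g, Under.UnderMorphism.ext (hX.hom_ext h𝔄 hX' (by simp)),
    Under.UnderMorphism.ext (hY.hom_ext h𝔄 hY' (by simp))⟩⟩

theorem TgdClosed.of_iso {X Y : Under I₀} (e : X ≅ Y) (hX : TgdClosed 𝔄 X.right) :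
    TgdClosed 𝔄 Y.right := by
  intro ξ hξ ht f
  have := (hX ξ hξ ht (f ≫ e.inv.right)).comp e.hom.right
  rwa [Category.assoc, ← Under.comp_right, e.inv_hom_id, Under.id_right, Category.comp_id] at this

end Chased

/-! ### Loops -/

section Loop

variable {α : Type*} {cond : α → Prop} {body : α →. α}

theorem mem_whileLoop_iff {a b : α} : b ∈ whileLoop cond body a ↔
    (¬ cond a ∧ b = a) ∨ (cond a ∧ ∃ a' ∈ body a, b ∈ whileLoop cond body a') := by
  refine PFun.mem_fix_iff.trans ?_
  change _ ∨ (∃ a', _ ∧ b ∈ whileLoop cond body a') ↔ _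
  by_cases ha : cond a
  · simp only [if_pos ha, Part.mem_map_iff]
    simp [ha]
  · simp only [if_neg ha, Part.mem_some_iff]
    simp [ha]

theorem mem_whileLoop_of_not {a : α} (ha : ¬ cond a) : a ∈ whileLoop cond body a :=
  mem_whileLoop_iff.2 (Or.inl ⟨ha, rfl⟩)

theorem mem_whileLoop_of_step {a a' b : α} (ha : cond a) (ha' : a' ∈ body a)
    (hb : b ∈ whileLoop cond body a') : b ∈ whileLoop cond body a :=
  mem_whileLoop_iff.2 (Or.inr ⟨ha, a', ha', hb⟩)

theorem whileLoop_inv {P : α → Prop} (hP : ∀ a, P a → cond a → ∀ a' ∈ body a, P a') {a b : α}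
    (ha : P a) (hb : b ∈ whileLoop cond body a) : P b ∧ ¬ cond b := by
  have key : ∀ a, b ∈ whileLoop cond body a → P a → P b ∧ ¬ cond b := by
    intro a hb
    refine PFun.fixInduction (C := fun a => P a → P b ∧ ¬ cond b) hb fun a hb' ih ha => ?_
    rcases (mem_whileLoop_iff (cond := cond) (body := body)).1 hb' with ⟨h, rfl⟩ | ⟨h, a', h', -⟩
    · exact ⟨ha, h⟩
    · exact ih a' (by simpa [h] using h') (hP a ha h a' h')
  exact key a hb ha

/-- Total correctness: an invariant together with a strictly decreasing natural-number measure. -/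
theorem whileLoop_total {P : α → Prop} (m : α → ℕ)
    (hP : ∀ a, P a → cond a → ∃ a' ∈ body a, P a' ∧ m a' < m a) {a : α} (ha : P a) :
    ∃ b ∈ whileLoop cond body a, P b ∧ ¬ cond b := by
  induction hn : m a using Nat.strong_induction_on generalizing a with
  | _ n ih =>
    by_cases hc : cond a
    · obtain ⟨a', ha', hPa', hlt⟩ := hP a ha hc
      obtain ⟨b, hb, hb'⟩ := ih (m a') (hn ▸ hlt) hPa' rfl
      exact ⟨b, mem_whileLoop_of_step hc ha' hb, hb'⟩
    · exact ⟨a, mem_whileLoop_of_not hc, ha, hc⟩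

variable {𝔄 : RegularTheory σ} {I₀ : Inst σ}

/-- A loop that chases, in each round, at least the active triggers of tgds and then saturates
under the egds terminates if `I₀` can be chased to a model in any way. -/
theorem whileLoop_dom {T : CartesianTheory σ} (h𝔄 : IsRewriting T 𝔄) (π : α → Under I₀)
    {P : α → Prop} (hchased : ∀ s, P s → Chased 𝔄 (π s))
    (hegd : ∀ s, P s → EgdClosed 𝔄 (π s).right)
    (hcond : ∀ s, P s → TgdClosed 𝔄 (π s).right → ¬ cond s)
    (hbody : ∀ s, P s → cond s → ∃ s' ∈ body s, P s' ∧ ∃ c : π s ⟶ π s',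
      ∀ ξ ∈ 𝔄, ξ.IsTgd → ∀ f : ξ.front ⟶ (π s).right, Factors ξ (f ≫ c.right))
    {R : Under I₀} (hR : Chased 𝔄 R) (hR₁ : EgdClosed 𝔄 R.right) (hR₂ : TgdClosed 𝔄 R.right)
    {s : α} (hs : P s) : ∃ b, b ∈ whileLoop cond body s := by
  -- Generalizing the start of the chain lets each round of the loop consume one chase step towards
  -- `R`.
  suffices ∀ X : Under I₀, Relation.ReflTransGen (ChaseRel 𝔄) X R →
      ∀ s, P s → Nonempty (X ⟶ π s) → ∃ b, b ∈ whileLoop cond body s from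
    this _ hR s hs ⟨Under.homMk (π s).hom (Category.id_comp _)⟩
  intro X hX
  induction hX using Relation.ReflTransGen.head_induction_on with
  | refl =>
    rintro s hs ⟨f⟩
    obtain ⟨g⟩ := (hchased s hs).exists_hom h𝔄 hR₁ hR₂
    obtain ⟨e⟩ := hR.iso h𝔄 (hchased s hs) hR₁ (hegd s hs) f g
    exact ⟨s, mem_whileLoop_of_not (hcond s hs (hR₂.of_iso e))⟩
  | head hXY _ ih =>
    rintro s hs ⟨f⟩
    by_cases hc : cond s
    · obtain ⟨s', hs', hPs', c, hcf⟩ := hbody s hs hc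
      obtain ⟨F, d, hd, hw⟩ := hXY
      obtain ⟨-, -, -, hdesc⟩ := hd.exists_universal
      -- The triggers chased in `d` are inactive after the round: those of egds because the new
      -- state is egd-closed, those of tgds because the round deactivated all of them.
      obtain ⟨n, hn⟩ := hdesc _ (f.right ≫ c.right) (fun t ht => by
        rw [← Category.assoc]
        rcases h𝔄.egd_or_tgd _ t.mem with h | h
        · exact hegd s' hPs' _ t.mem h _
        · exact hcf _ t.mem h _)
      obtain ⟨b, hb⟩ := ih s' hPs' ⟨Under.homMk n (by
        rw [← hw, Category.assoc, hn, ← Category.assoc, Under.w, Under.w])⟩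
      exact ⟨b, mem_whileLoop_of_step hc hs' hb⟩
    · exact ⟨s, mem_whileLoop_of_not hc⟩

end Loop

/-! ### The fast parallel chase -/

section Fast

variable {𝔄 : RegularTheory σ} (C : ParallelChase 𝔄) {I₀ : Inst σ}

theorem activeEgd_not_nonempty {I : Inst σ} : ¬ (activeEgd 𝔄 I).Nonempty ↔ EgdClosed 𝔄 I := by
  constructor
  · intro h ξ hξ he f
    by_contra hf
    exact h ⟨⟨ξ, hξ, f⟩, he, hf⟩
  · rintro h ⟨t, ht, ht'⟩
    exact ht' (h _ t.mem ht _)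

theorem activeTgd_not_nonempty {I : Inst σ} : ¬ (activeTgd 𝔄 I).Nonempty ↔ TgdClosed 𝔄 I := by
  constructor
  · intro h ξ hξ he f
    by_contra hf
    exact h ⟨⟨ξ, hξ, f⟩, he, hf⟩
  · rintro h ⟨t, ht, ht'⟩
    exact ht' (h _ t.mem ht _)

theorem fastEgdLoop_total (h𝔄 : 𝔄.Finite) {X : Under I₀} (hX : Chased 𝔄 X)
    (hX' : X.right.FinElts) :
    ∃ Y ∈ fastEgdLoop C X,
      (Chased 𝔄 Y ∧ Y.right.FinElts ∧ Nonempty (X ⟶ Y)) ∧ EgdClosed 𝔄 Y.right := by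
  obtain ⟨Y, hY, hPY, hY'⟩ := whileLoop_total
    (cond := fun s : Under I₀ => (activeEgd 𝔄 s.right).Nonempty)
    (body := fun s =>
      Part.some (Under.mk (s.hom ≫ C.hom s.right (activeEgd 𝔄 s.right))))
    (P := fun Y => Chased 𝔄 Y ∧ Y.right.FinElts ∧ Nonempty (X ⟶ Y))
    (fun Y => Y.right.numElts)
    (by
      rintro Y ⟨h1, h2, ⟨f⟩⟩ hne
      have hc := C.isStep Y.right (activeEgd 𝔄 Y.right)
      exact ⟨_, Part.mem_some _, ⟨Chased.step (i := Y.hom) h1 hc, hc.finElts h𝔄 h2,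
        ⟨f ≫ Under.homMk (C.hom Y.right (activeEgd 𝔄 Y.right)) rfl⟩⟩,
        hc.numElts_lt h2 (fun _ ht => ht) hne⟩)
    (a := X) ⟨hX, hX', ⟨𝟙 X⟩⟩
  exact ⟨Y, hY, hPY, activeEgd_not_nonempty.1 hY'⟩

/-- The states of the fast parallel chase after the first round. -/
def FastGood (𝔄 : RegularTheory σ) (s : Under I₀ × Bool) : Prop :=
  Chased 𝔄 s.1 ∧ s.1.right.FinElts ∧ EgdClosed 𝔄 s.1.right ∧ s.2 = false

/-- One round; closure under the egds is not presupposed, so this covers the first round too. -/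
theorem fast_body (h𝔄 : 𝔄.Finite) {X : Under I₀} (hX : Chased 𝔄 X) (hX' : X.right.FinElts) :
    ∃ s' ∈ (fastEgdLoop C (Under.mk (X.hom ≫ C.hom X.right (activeTgd 𝔄 X.right)))).map
        (fun t => (t, false)),
      FastGood 𝔄 s' ∧ ∃ c : X ⟶ s'.1,
        ∀ ξ ∈ 𝔄, ξ.IsTgd → ∀ f : ξ.front ⟶ X.right, Factors ξ (f ≫ c.right) := by
  have hc := C.isStep X.right (activeTgd 𝔄 X.right)
  obtain ⟨Y, hY, ⟨h1, h2, ⟨f⟩⟩, h3⟩ := fastEgdLoop_total C h𝔄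
    (Chased.step (i := X.hom) hX hc) (hc.finElts h𝔄 hX')
  refine ⟨(Y, false), Part.mem_map _ hY, ⟨h1, h2, h3, rfl⟩,
    Under.homMk (C.hom X.right (activeTgd 𝔄 X.right)) rfl ≫ f, fun ξ hξ ht g => ?_⟩
  by_cases hg : Factors ξ g
  · exact hg.comp _
  · have := (hc.factors (t := ⟨ξ, hξ, g⟩) ⟨ht, hg⟩).comp f.right
    rwa [Category.assoc] at this

theorem fast_spec {T : CartesianTheory σ} (h𝔄 : IsRewriting T 𝔄) (hfin : 𝔄.Finite)
    (hI₀ : I₀.FinElts) :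
    (∀ R ∈ fastChase C I₀, Chased 𝔄 R ∧ EgdClosed 𝔄 R.right ∧ TgdClosed 𝔄 R.right) ∧
      ∀ R : Under I₀, Chased 𝔄 R → EgdClosed 𝔄 R.right → TgdClosed 𝔄 R.right →
        (fastChase C I₀).Dom := by
  obtain ⟨s₁, hs₁, hgood, -⟩ := fast_body C hfin (X := Under.mk (𝟙 I₀)) .refl hI₀
  have hcond : ∀ s : Under I₀ × Bool, FastGood 𝔄 s →
      (¬ ((activeTgd 𝔄 s.1.right).Nonempty ∨ s.2 = true) ↔ TgdClosed 𝔄 s.1.right) := by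
    rintro s ⟨-, -, -, hs⟩
    rw [← activeTgd_not_nonempty]
    simp [hs]
  constructor
  · intro R hR
    obtain ⟨s, hs, rfl⟩ := (Part.mem_map_iff _).1 hR
    -- The flag forces a first round. The invariant is only available afterwards, since `I₀` may
    -- violate egds.
    rcases mem_whileLoop_iff.1 hs with ⟨h, -⟩ | ⟨-, s', hs', hs⟩
    · exact (h (Or.inr rfl)).elim
    obtain rfl := Part.mem_unique hs₁ hs'
    obtain ⟨hg, hc⟩ := whileLoop_inv (P := FastGood 𝔄) (by
      rintro a ⟨h1, h2, -⟩ - a' ha'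
      obtain ⟨a'', ha'', hg, -⟩ := fast_body C hfin h1 h2
      exact Part.mem_unique ha'' ha' ▸ hg) hgood hs
    exact ⟨hg.1, hg.2.2.1, (hcond s hg).1 hc⟩
  · intro R hR hR₁ hR₂
    obtain ⟨b, hb⟩ := whileLoop_dom h𝔄 Prod.fst (fun s hs => hs.1) (fun s hs => hs.2.2.1)
      (fun s hs => (hcond s hs).2) (fun s hs _ => fast_body C hfin hs.1 hs.2.1) hR hR₁ hR₂ hgood
    exact Part.dom_iff_mem.2 ⟨_, Part.mem_map _
      (mem_whileLoop_of_step (a := (Under.mk (𝟙 I₀), true)) (Or.inr rfl) hs₁ hb)⟩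

end Fast

/-! ### The semi-naive algorithm -/

section SemiNaive

variable {𝔄 : RegularTheory σ} (E : EditChase 𝔄) {I₀ : Inst σ}

/-- An old morphism factors through the edit. -/
theorem Edit.IsOld.exists_fac {I J K : Inst σ} {e : Edit I J} {f : K ⟶ J} (hf : e.IsOld f) :
    ∃ g : K ⟶ I, g ≫ e.hom = f := by
  have hinj : ∀ s, Function.Injective (Inst.Hom.app e.j s) := by
    intro s x y hxy
    -- `D` has a single element, of sort `s`, and no tuples: it represents elements of sort `s`, so
    -- monomorphisms are injective.
    let D : Inst σ := ⟨fun t => ULift (PLift (t = s)), fun _ => ∅⟩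
    let m (z : e.A.carrier s) : D ⟶ e.A :=
      Inst.Hom.mk (fun t p => p.down.down ▸ z) (fun _ _ h => h.elim)
    have hm : m x ≫ e.j = m y ≫ e.j := by
      apply Inst.Hom.ext
      funext t ⟨⟨p⟩⟩
      subst p
      exact hxy
    have := e.mono_j
    have h2 := (cancel_mono e.j).1 hm
    exact congrArg (fun w : D ⟶ e.A => Inst.Hom.app w s ⟨⟨rfl⟩⟩) h2
  obtain ⟨h1, h2⟩ := hf
  choose k hk using fun s x => h1 s ⟨x, rfl⟩
  let k' : K ⟶ e.A := Inst.Hom.mk k (by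
    intro r v hv
    obtain ⟨w, hw, hwv⟩ := h2 r ⟨v, hv, rfl⟩
    have : w = fun n => k _ (v n) := by
      funext n
      apply hinj
      rw [hk]
      exact congrFun hwv n
    exact this ▸ hw)
  refine ⟨k' ≫ e.i, ?_⟩
  rw [Category.assoc, e.w]
  apply Inst.Hom.ext
  funext s x
  exact hk s x

theorem Edit.isEmptyInst_of_isOld_fromEmpty {I K : Inst σ} {f : K ⟶ I}
    (hf : (Edit.fromEmpty I).IsOld f) : K.IsEmptyInst := by
  refine ⟨fun s => ⟨fun x => ?_⟩, fun r => Set.eq_empty_of_forall_notMem fun v hv => ?_⟩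
  · obtain ⟨y, -⟩ := hf.1 s ⟨x, rfl⟩
    exact PEmpty.elim y
  · obtain ⟨w, hw, -⟩ := hf.2 r ⟨v, hv, rfl⟩
    exact hw.elim

/-- Old triggers of the dependencies with property `p` are inactive. -/
def OldClosed (𝔄 : RegularTheory σ) (p : ED σ → Prop) {J I : Inst σ} (e : Edit J I) : Prop :=
  ∀ ξ ∈ 𝔄, p ξ → ∀ f : ξ.front ⟶ I, e.IsOld f → Factors ξ f

/-- Only the underlying morphism of the edit enters, which is why the choice of `A` is immaterial.
-/
theorem OldClosed.of_hom {p : ED σ → Prop} {J I : Inst σ} {e : Edit J I}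
    (h : ∀ ξ ∈ 𝔄, p ξ → ∀ f : ξ.front ⟶ J, Factors ξ (f ≫ e.hom)) : OldClosed 𝔄 p e := by
  intro ξ hξ hp f hf
  obtain ⟨g, rfl⟩ := hf.exists_fac
  exact h ξ hξ hp g

/-- If old triggers are inactive, chasing the new active triggers deactivates all triggers. -/
theorem OldClosed.factors {p : ED σ → Prop} {J I I' : Inst σ} {e : Edit J I}
    (he : OldClosed 𝔄 p e) {F : Set (Trigger 𝔄 I)} {c : I ⟶ I'} (hc : IsParallelChaseStep F c)
    (hF : ∀ t : Trigger 𝔄 I, p t.ξ → e.IsNew t.hom → t.IsActive → t ∈ F)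
    {ξ : ED σ} (hξ : ξ ∈ 𝔄) (hp : p ξ) (f : ξ.front ⟶ I) : Factors ξ (f ≫ c) := by
  by_cases hf : Factors ξ f
  · exact hf.comp c
  · exact hc.factors (hF ⟨ξ, hξ, f⟩ hp (fun h => hf (he ξ hξ hp f h)) hf)

/-- Justifies the exit test: ignoring old triggers cannot hide an active one. -/
theorem newEgd_not_nonempty {J I : Inst σ} {e : Edit J I} (he : OldClosed 𝔄 ED.IsEgd e) :
    ¬ (newEgd 𝔄 e).Nonempty ↔ EgdClosed 𝔄 I := by
  constructor
  · intro h ξ hξ hp f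
    by_contra hf
    exact h ⟨⟨ξ, hξ, f⟩, hp, fun ho => hf (he ξ hξ hp f ho), hf⟩
  · rintro h ⟨t, ht, -, ht'⟩
    exact ht' (h _ t.mem ht _)

theorem newTgd_not_nonempty {J I : Inst σ} {e : Edit J I} (he : OldClosed 𝔄 ED.IsTgd e) :
    ¬ (newTgd 𝔄 e).Nonempty ↔ TgdClosed 𝔄 I := by
  constructor
  · intro h ξ hξ hp f
    by_contra hf
    exact h ⟨⟨ξ, hξ, f⟩, hp, fun ho => hf (he ξ hξ hp f ho), hf⟩
  · rintro h ⟨t, ht, -, ht'⟩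
    exact ht' (h _ t.mem ht _)

/-! ### Dependencies with empty front -/

/-- Triggers of dependencies with empty front are inactive. -/
def EmptyClosed (𝔄 : RegularTheory σ) (I : Inst σ) : Prop :=
  ∀ ξ ∈ 𝔄, ξ.front.IsEmptyInst → ∀ f : ξ.front ⟶ I, Factors ξ f

theorem Inst.IsEmptyInst.hom_ext {K I : Inst σ} (hK : K.IsEmptyInst) (f g : K ⟶ I) : f = g := by
  apply Inst.Hom.ext
  funext s x
  exact ((hK.1 s).false x).elim

/-- The unique morphism out of an empty instance. -/
def Inst.IsEmptyInst.hom {K : Inst σ} (hK : K.IsEmptyInst) (I : Inst σ) : K ⟶ I :=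
  Inst.Hom.mk (fun s x => ((hK.1 s).false x).elim) (fun r v hv => by simp [hK.2 r] at hv)

/-- An empty front has only one map to `I'`, and it passes through `I`, where it was inactive or
chased. -/
theorem IsParallelChaseStep.emptyClosed {I I' : Inst σ} {c : I ⟶ I'}
    (hc : IsParallelChaseStep (activeEmptyFront 𝔄 I) c) : EmptyClosed 𝔄 I' := by
  intro ξ hξ he f
  rw [he.hom_ext f (he.hom I ≫ c)]
  by_cases hf : Factors ξ (he.hom I)
  · exact hf.comp c
  · exact hc.factors (t := ⟨ξ, hξ, he.hom I⟩) ⟨he, hf⟩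

theorem EmptyClosed.mono {I I' : Inst σ} (hI : EmptyClosed 𝔄 I) (c : I ⟶ I') :
    EmptyClosed 𝔄 I' := by
  intro ξ hξ he f
  rw [he.hom_ext f (he.hom I ≫ c)]
  exact (hI ξ hξ he _).comp c

theorem EmptyClosed.oldClosed {I : Inst σ} (hI : EmptyClosed 𝔄 I) (p : ED σ → Prop) :
    OldClosed 𝔄 p (Edit.fromEmpty I) :=
  fun ξ hξ _ f hf => hI ξ hξ (Edit.isEmptyInst_of_isOld_fromEmpty hf) f

/-! ### Invariants of the semi-naive loops -/

/-- The invariant of the inner loop of the semi-naive algorithm. -/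
structure EgdInv (𝔄 : RegularTheory σ) {Itgd : Inst σ} (i : I₀ ⟶ Itgd) (t : EgdState I₀ Itgd) :
    Prop where
  chased : Chased 𝔄 (Under.mk t.i)
  fin : t.I.FinElts
  w : i ≫ t.eTgd.hom = t.i
  tgd : ∀ ξ ∈ 𝔄, ξ.IsTgd → ∀ f : ξ.front ⟶ Itgd, Factors ξ (f ≫ t.eTgd.hom)
  old : OldClosed 𝔄 ED.IsEgd t.eEgd

theorem semiEgdLoop_total (hfin : 𝔄.Finite) {Itgd : Inst σ} {i : I₀ ⟶ Itgd}
    {t : EgdState I₀ Itgd} (ht : EgdInv 𝔄 i t) :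
    ∃ t' ∈ semiEgdLoop E Itgd t, EgdInv 𝔄 i t' ∧ EgdClosed 𝔄 t'.I := by
  obtain ⟨t', ht', hinv, hc⟩ := whileLoop_total
    (cond := fun s : EgdState I₀ Itgd => (newEgd 𝔄 s.eEgd).Nonempty)
    (body := fun s =>
      let c := E.edit s.I (newEgd 𝔄 s.eEgd)
      Part.some
        { I := _
          i := s.i ≫ c.hom
          eTgd := s.eTgd.comp c
          prev := s.I
          eEgd := c })
    (P := EgdInv 𝔄 i) (fun s => s.I.numElts)
    (by
      intro s hs hne
      have hc := E.isStep s.I (newEgd 𝔄 s.eEgd)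
      refine ⟨_, Part.mem_some _, ⟨hs.chased.step hc, hc.finElts hfin hs.fin, ?_, ?_, ?_⟩,
        hc.numElts_lt hs.fin (fun _ ht => ⟨ht.1, ht.2.2⟩) hne⟩
      · exact (Category.assoc _ _ _).symm.trans (by rw [hs.w])
      · intro ξ hξ hp f
        have := (hs.tgd ξ hξ hp f).comp (E.edit s.I (newEgd 𝔄 s.eEgd)).hom
        rwa [Category.assoc] at this
      -- The invariant renews itself: in `s.I` old triggers were inactive, and the new active ones
      -- have just been chased.
      · exact OldClosed.of_hom fun ξ hξ hp f =>
          hs.old.factors hc (fun t h1 h2 h3 => ⟨h1, h2, h3⟩) hξ hp f)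
    ht
  exact ⟨t', ht', hinv, (newEgd_not_nonempty hinv.old).1 hc⟩

/-- The invariant of the outer loop of the semi-naive algorithm. -/
structure TgdInv (𝔄 : RegularTheory σ) (s : TgdState I₀) : Prop where
  chased : Chased 𝔄 (Under.mk s.i)
  fin : s.I.FinElts
  old : OldClosed 𝔄 ED.IsTgd s.e
  empty : s.first = true → EmptyClosed 𝔄 s.I
  egd : s.first = false → EgdClosed 𝔄 s.I

/-- In the first round `s.I` need not be egd-closed, so only triggers with empty front may count as
old. Later it is, and inactive triggers stay inactive along `C(TGD)`. -/
theorem TgdInv.init (hfin : 𝔄.Finite) {s : TgdState I₀} (hs : TgdInv 𝔄 s) :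
    EgdInv 𝔄 s.i (semiEgdInit E s) := by
  obtain ⟨I, i, prev, e, first⟩ := s
  have hc := E.isStep I (newTgd 𝔄 e)
  have htgd : ∀ ξ ∈ 𝔄, ξ.IsTgd → ∀ f : ξ.front ⟶ I,
      Factors ξ (f ≫ (E.edit I (newTgd 𝔄 e)).hom) := fun ξ hξ hp f =>
    hs.old.factors hc (fun t h1 h2 h3 => ⟨h1, h2, h3⟩) hξ hp f
  cases first with
  | true =>
    exact ⟨hs.chased.step hc, hc.finElts hfin hs.fin, rfl, htgd,
      ((hs.empty rfl).mono (E.edit I (newTgd 𝔄 e)).hom).oldClosed _⟩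
  | false =>
    exact ⟨hs.chased.step hc, hc.finElts hfin hs.fin, rfl, htgd,
      OldClosed.of_hom fun ξ hξ hp f => (hs.egd rfl ξ hξ hp f).comp _⟩

/-- The composite edit `t.eTgd` starts at `s.I` and deactivates all its tgd triggers, so those that
are old in the next round are inactive. -/
theorem TgdInv.body (hfin : 𝔄.Finite) {s : TgdState I₀} (hs : TgdInv 𝔄 s) :
    ∃ s' ∈ (semiEgdLoop E s.I (semiEgdInit E s)).map (fun t =>
        ({ I := t.I, i := t.i, prev := s.I, e := t.eTgd, first := false } : TgdState I₀)),
      (TgdInv 𝔄 s' ∧ s'.first = false) ∧ ∃ c : Under.mk s.i ⟶ Under.mk s'.i,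
        ∀ ξ ∈ 𝔄, ξ.IsTgd → ∀ f : ξ.front ⟶ s.I, Factors ξ (f ≫ c.right) := by
  obtain ⟨t, ht, hinv, hegd⟩ := semiEgdLoop_total E hfin (hs.init E hfin)
  refine ⟨_, Part.mem_map _ ht, ⟨⟨hinv.chased, hinv.fin, OldClosed.of_hom hinv.tgd, ?_,
    fun _ => hegd⟩, rfl⟩, Under.homMk t.eTgd.hom hinv.w, hinv.tgd⟩
  rintro ⟨⟩

theorem semiNaive_spec {T : CartesianTheory σ} (h𝔄 : IsRewriting T 𝔄) (hfin : 𝔄.Finite)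
    (hI₀ : I₀.FinElts) :
    (∀ R ∈ semiNaiveChase E I₀, Chased 𝔄 R ∧ EgdClosed 𝔄 R.right ∧ TgdClosed 𝔄 R.right) ∧
      ∀ R : Under I₀, Chased 𝔄 R → EgdClosed 𝔄 R.right → TgdClosed 𝔄 R.right →
        (semiNaiveChase E I₀).Dom := by
  have hstep := E.isStep I₀ (activeEmptyFront 𝔄 I₀)
  let s₀ : TgdState I₀ :=
    { I := _
      i := (E.edit I₀ (activeEmptyFront 𝔄 I₀)).hom
      prev := Inst.empty σ
      e := Edit.fromEmpty _
      first := true }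
  have hs₀ : TgdInv 𝔄 s₀ := by
    refine ⟨Relation.ReflTransGen.single ⟨_, _, hstep, Category.id_comp _⟩,
      hstep.finElts hfin hI₀, hstep.emptyClosed.oldClosed _, fun _ => hstep.emptyClosed, ?_⟩
    rintro ⟨⟩
  obtain ⟨s₁, hs₁, hgood, -⟩ := hs₀.body E hfin
  have hcond : ∀ s : TgdState I₀, TgdInv 𝔄 s ∧ s.first = false →
      (¬ ((newTgd 𝔄 s.e).Nonempty ∨ s.first = true) ↔ TgdClosed 𝔄 s.I) := by
    rintro s ⟨hs, hf⟩
    rw [← newTgd_not_nonempty hs.old]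
    simp [hf]
  constructor
  · intro R hR
    obtain ⟨s, hs, rfl⟩ := (Part.mem_map_iff _).1 hR
    rcases mem_whileLoop_iff.1 hs with ⟨h, -⟩ | ⟨-, s', hs', hs⟩
    · exact (h (Or.inr rfl)).elim
    obtain rfl := Part.mem_unique hs₁ hs'
    obtain ⟨hg, hc⟩ := whileLoop_inv (P := fun s => TgdInv 𝔄 s ∧ s.first = false) (by
      rintro a ⟨h1, -⟩ - a' ha'
      obtain ⟨a'', ha'', hg, -⟩ := h1.body E hfin
      exact Part.mem_unique ha'' ha' ▸ hg) hgood hs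
    exact ⟨hg.1.chased, hg.1.egd hg.2, (hcond s hg).1 hc⟩
  · intro R hR hR₁ hR₂
    obtain ⟨b, hb⟩ := whileLoop_dom h𝔄 (fun s : TgdState I₀ => Under.mk s.i)
      (fun s hs => hs.1.chased) (fun s hs => hs.1.egd hs.2)
      (fun s hs => (hcond s hs).2) (fun s hs _ => hs.1.body E hfin) hR hR₁ hR₂ hgood
    exact Part.dom_iff_mem.2 ⟨_, Part.mem_map _
      (mem_whileLoop_of_step (a := s₀) (Or.inr rfl) hs₁ hb)⟩

end SemiNaive

end Chase

theorem mainTheorem10 {σ : Chase.Signature.{u}} (T : Chase.CartesianTheory σ)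
    (𝔄 : Chase.RegularTheory σ) (h𝔄 : Chase.IsRewriting T 𝔄) (hfin : 𝔄.Finite)
    (C : Chase.ParallelChase 𝔄) (E : Chase.EditChase 𝔄)
    (I₀ : Chase.Inst σ) (hI₀ : I₀.IsFinite) :
    ((Chase.semiNaiveChase E I₀).Dom ↔ (Chase.fastChase C I₀).Dom) ∧
      ∀ R ∈ Chase.semiNaiveChase E I₀, ∀ R' ∈ Chase.fastChase C I₀, Nonempty (R ≅ R') := by
  obtain ⟨hs, hs'⟩ := Chase.semiNaive_spec E h𝔄 hfin hI₀.1
  obtain ⟨hf, hf'⟩ := Chase.fast_spec C h𝔄 hfin hI₀.1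
  refine ⟨⟨fun h => ?_, fun h => ?_⟩, fun R hR R' hR' => ?_⟩
  · obtain ⟨R, hR⟩ := Part.dom_iff_mem.1 h
    obtain ⟨h1, h2, h3⟩ := hs R hR
    exact hf' R h1 h2 h3
  · obtain ⟨R, hR⟩ := Part.dom_iff_mem.1 h
    obtain ⟨h1, h2, h3⟩ := hf R hR
    exact hs' R h1 h2 h3
  · obtain ⟨h1, h2, h3⟩ := hs R hR
    obtain ⟨h1', h2', h3'⟩ := hf R' hR'
    obtain ⟨f⟩ := h1.exists_hom h𝔄 h2' h3'
    obtain ⟨g⟩ := h1'.exists_hom h𝔄 h2 h3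
    exact h1.iso h𝔄 h1' h2 h2' f g
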